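/- Throughout, $\mathbb{R}^d$ carries the Euclidean norm, $B_r(g)$ is the open ball, and for a locally Lipschitz $f:\mathbb{R}^d\to\mathbb{R}$ the Clarke subdifferential is $$\partial f(x)=\mathrm{conv}\{\lim_{n}\nabla f(p_n) : p_n\to x,\ f \text{ differentiable at every } p_n\}.$$ A point $x$ is Clarke critical if $0\in\partial f(x)$. The algorithm $\mathtt{NTD}(x_0,g_0,c_0,\{G_k\},\{T_k\})$ is built from the following procedures. * $\mathtt{TDescent}(x,g,\sigma,T)$: set $a_0=g$, $t=0$. While $t\le T-1$, $\|a_t\|>0$ and $\frac{\sigma}{8}\|a_t\|\ge f(x)-f\big(x-\sigma\frac{a_t}{\|a_t\|}\big)$: choose $\hat a_t\in\partial f\big(x-\sigma\frac{a_t}{\|a_t\|}\big)$, set $a_{t+1}=\mathrm{argmin}_{z\in[a_t,\hat a_t]}\|z\|$ and increase $t$ by one. Return $a_t$. * $\mathtt{NDescent}(x,g,\sigma,T)$: the same loop, with the choice of $\hat a_t$ replaced by: choose any $r$ with $0<r<\sigma\|a_t\|$; sample $\zeta_t$ uniformly from $B_r(a_t)$; sample $y_t$ uniformly from the segment $[x,x-\sigma\frac{\zeta_t}{\|\zeta_t\|}]$;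 choose $\hat a_t\in\partial f(y_t)$, where $\hat a_t=\nabla f(y_t)$ almost surely on the event that $f$ is differentiable at $y_t$. * $\mathtt{linesearch}(x,g,s,G,T)$: set $v_0=g$; for $i=0,\dots,G-1$ let $\sigma_i=2^{-(G-i)}$, $u_i=\mathtt{TDescent}(x,v_i,\sigma_i,T)$, $v_{i+1}=\mathtt{NDescent}(x,u_i,\sigma_i,T)$. Return a minimizer of $f$ over the finite set $\{x\}\cup\{x-\sigma_i\frac{v_{i+1}}{\|v_{i+1}\|} : 0\le i\le G-1,\ \sigma_i\le\|v_{i+1}\|/s\}$. * $\mathtt{NTD}$: for $k=0,1,\dots$ set $x_{k+1}=\mathtt{linesearch}\big(x_k,g_k,\max\{\|g_k\|,c_0\|g_0\|\},G_k,T_k\big)$ and choose $g_{k+1}\in\partial f(x_{k+1})$. All choices (subgradients, radii $r$, ties) may depend on the past and on additional randomization, but are made without knowledge of later samples; all iterates and radii are random variables, and each sample is drawn, conditionally on everything before it, with the stated uniform law. **Corollary (Limiting points are Clarke critical).** Let $f:\mathbb{R}^d\to\mathbb{R}$ be locally Lipschitz, let $x_0\in\mathbb{R}^d$ and $g_0\in\partial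 f(x_0)$ with $g_0\ne0$, and suppose that the sublevel set $\{x : f(x)\le f(x_0)\}$ is bounded. Fix $c_0\in(0,1]$, grid sizes $G_k\in\mathbb{N}$ with $G_k\to\infty$ and budgets $T_k\in\mathbb{N}$ with $T_k\ge k$ for all $k$. Let $\{x_k\}$ be generated by $\mathtt{NTD}(x_0,g_0,c_0,\{G_k\},\{T_k\})$. Then, with probability one, every limit point of $\{x_k\}$ is Clarke critical. -/

import Mathlib

open MeasureTheory ProbabilityTheory Filter Topology

noncomputable section

/-- The Clarke subdifferential of `f : ℝᵈ → ℝ` at `x`: the convex hull of all limits of gradients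
of `f` along sequences of differentiability points of `f` converging to `x`. -/
def clarkeSubdifferential {d : ℕ} (f : EuclideanSpace ℝ (Fin d) → ℝ)
    (x : EuclideanSpace ℝ (Fin d)) : Set (EuclideanSpace ℝ (Fin d)) :=
  convexHull ℝ {v | ∃ p : ℕ → EuclideanSpace ℝ (Fin d), Tendsto p atTop (𝓝 x) ∧
    (∀ n, DifferentiableAt ℝ f (p n)) ∧ Tendsto (fun n => gradient f (p n)) atTop (𝓝 v)}

/-- `x` is Clarke critical for `f`. -/
def IsClarkeCritical {d : ℕ} (f : EuclideanSpace ℝ (Fin d) → ℝ)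
    (x : EuclideanSpace ℝ (Fin d)) : Prop :=
  0 ∈ clarkeSubdifferential f x

/-- The normalized step `x - σ g / ‖g‖` (only used where `g ≠ 0`). -/
def normalizedStep {d : ℕ} (x g : EuclideanSpace ℝ (Fin d)) (σ : ℝ) :
    EuclideanSpace ℝ (Fin d) :=
  x - (σ / ‖g‖) • g

/-- The part of the guard of the two while loops that does not involve the budget:
`g ≠ 0` and the step along `-g` of length `σ` does not achieve descent. -/
def NoDescent {d : ℕ} (f : EuclideanSpace ℝ (Fin d) → ℝ) (x g : EuclideanSpace ℝ (Fin d))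
    (σ : ℝ) : Prop :=
  0 < ‖g‖ ∧ f x - f (normalizedStep x g σ) ≤ σ / 8 * ‖g‖

/-- `z = argmin {‖w‖ : w ∈ [a, b]}`. -/
def IsShortestInSegment {d : ℕ} (a b z : EuclideanSpace ℝ (Fin d)) : Prop :=
  z ∈ segment ℝ a b ∧ ∀ w ∈ segment ℝ a b, ‖z‖ ≤ ‖w‖

/-- The sampled point of the normal descent loop. With `ξ` in the unit ball, `ζ = g + r ξ` is the
perturbed direction in the ball of radius `r` around `g`, and with `θ` in `[0, 1]` the sampled
point is the point of parameter `θ` on the segment from `x` to `x - σ ζ / ‖ζ‖`. If `ξ` is uniform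
in the open unit ball and `θ` is uniform in `[0, 1]`, independently, then `ζ` is uniform in the
open ball `B_r(g)` and the sampled point is uniform on the segment. -/
def samplePoint {d : ℕ} (x g : EuclideanSpace ℝ (Fin d)) (σ r : ℝ)
    (ξ : EuclideanSpace ℝ (Fin d)) (θ : ℝ) : EuclideanSpace ℝ (Fin d) :=
  AffineMap.lineMap x (normalizedStep x (g + r • ξ) σ) θ

/-- `a 0, …, a T` is the sequence of iterates of a run of `TDescent(x, g, σ, T)` which uses the
subgradients `s t`; after the loop has stopped the iterate is frozen, so that the value returned
by the call is `a T`. -/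
structure IsTDescentRun {d : ℕ} (f : EuclideanSpace ℝ (Fin d) → ℝ)
    (x g : EuclideanSpace ℝ (Fin d)) (σ : ℝ) (T : ℕ)
    (a s : ℕ → EuclideanSpace ℝ (Fin d)) : Prop where
  init : a 0 = g
  choose_mem : ∀ t < T, NoDescent f x (a t) σ →
    s t ∈ clarkeSubdifferential f (normalizedStep x (a t) σ)
  step : ∀ t < T, NoDescent f x (a t) σ → IsShortestInSegment (a t) (s t) (a (t + 1))
  frozen : ∀ t < T, ¬ NoDescent f x (a t) σ → a (t + 1) = a t

/-- `a 0, …, a T` is the sequence of iterates of a run of `NDescent(x, g, σ, T)` which uses the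
perturbation radii `r t`, the noise `ξ t`, `θ t` and the subgradients `s t`; after the loop has
stopped the iterate is frozen, so that the value returned by the call is `a T`. -/
structure IsNDescentRun {d : ℕ} (f : EuclideanSpace ℝ (Fin d) → ℝ)
    (x g : EuclideanSpace ℝ (Fin d)) (σ : ℝ) (T : ℕ)
    (a s : ℕ → EuclideanSpace ℝ (Fin d)) (r : ℕ → ℝ)
    (ξ : ℕ → EuclideanSpace ℝ (Fin d)) (θ : ℕ → ℝ) : Prop where
  init : a 0 = g
  radius_mem : ∀ t < T, NoDescent f x (a t) σ → 0 < r t ∧ r t < σ * ‖a t‖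
  choose_mem : ∀ t < T, NoDescent f x (a t) σ →
    s t ∈ clarkeSubdifferential f (samplePoint x (a t) σ (r t) (ξ t) (θ t))
  step : ∀ t < T, NoDescent f x (a t) σ → IsShortestInSegment (a t) (s t) (a (t + 1))
  frozen : ∀ t < T, ¬ NoDescent f x (a t) σ → a (t + 1) = a t

/-- The `i`-th trial radius `σ_i = 2^{-(G - i)}`, `i < G`, of the line search. -/
def gridRadius (G i : ℕ) : ℝ := (2 : ℝ)⁻¹ ^ (G - i)

/-- The candidates of the line search at `x` with trust region parameter `s`: the point `x` and
the points `x - σ_i v_{i+1} / ‖v_{i+1}‖`, `i < G`, with `σ_i ≤ ‖v_{i+1}‖ / s`. -/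
def linesearchCandidates {d : ℕ} (x : EuclideanSpace ℝ (Fin d)) (s : ℝ) (G : ℕ)
    (v : ℕ → EuclideanSpace ℝ (Fin d)) : Set (EuclideanSpace ℝ (Fin d)) :=
  {x} ∪ {z | ∃ i < G, gridRadius G i ≤ ‖v (i + 1)‖ / s ∧
    z = normalizedStep x (v (i + 1)) (gridRadius G i)}

/-- The index of the moment just before the `t`-th sampling in the `i`-th call of `NDescent` in the `k`-th
outer iteration. Moments are ordered lexicographically, which is the order of execution. -/
def drawIndex (k i t : ℕ) : ℕ ×ₗ (ℕ ×ₗ ℕ) := toLex (k, toLex (i, t))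

/-- A random run of `NTD(x₀, g₀, c₀, {G_k}, {T_k})` for `f` on a probability space `(Ω, P)`. -/
structure NTDRun {d : ℕ} {Ω : Type*} [MeasurableSpace Ω] (P : Measure Ω)
    (f : EuclideanSpace ℝ (Fin d) → ℝ) (x₀ g₀ : EuclideanSpace ℝ (Fin d)) (c₀ : ℝ)
    (G T : ℕ → ℕ) where
  /-- the iterates `x_k` -/
  x : ℕ → Ω → EuclideanSpace ℝ (Fin d)
  /-- the subgradients `g_k ∈ ∂f(x_k)` -/
  g : ℕ → Ω → EuclideanSpace ℝ (Fin d)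
  /-- `v k i` is the vector `v_i` of the line search in outer iteration `k` -/
  v : ℕ → ℕ → Ω → EuclideanSpace ℝ (Fin d)
  /-- inner iterates of the `i`-th call of `TDescent` in outer iteration `k` -/
  tIter : ℕ → ℕ → ℕ → Ω → EuclideanSpace ℝ (Fin d)
  /-- subgradients chosen in the `i`-th call of `TDescent` in outer iteration `k` -/
  tSub : ℕ → ℕ → ℕ → Ω → EuclideanSpace ℝ (Fin d)
  /-- inner iterates of the `i`-th call of `NDescent` in outer iteration `k` -/
  nIter : ℕ → ℕ → ℕ → Ω → EuclideanSpace ℝ (Fin d)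
  /-- subgradients chosen in the `i`-th call of `NDescent` in outer iteration `k` -/
  nSub : ℕ → ℕ → ℕ → Ω → EuclideanSpace ℝ (Fin d)
  /-- perturbation radii chosen in the `i`-th call of `NDescent` in outer iteration `k` -/
  radius : ℕ → ℕ → ℕ → Ω → ℝ
  /-- the noise behind the perturbed direction -/
  ξ : ℕ → ℕ → ℕ → Ω → EuclideanSpace ℝ (Fin d)
  /-- the noise behind the position on the segment -/
  θ : ℕ → ℕ → ℕ → Ω → ℝ
  /-- the history of the run (all the choices of the user included) -/
  hist : Filtration (ℕ ×ₗ (ℕ ×ₗ ℕ)) (inferInstance : MeasurableSpace Ω)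
  -- the algorithm
  x_zero : ∀ ω, x 0 ω = x₀
  g_zero : ∀ ω, g 0 ω = g₀
  g_mem : ∀ k ω, g (k + 1) ω ∈ clarkeSubdifferential f (x (k + 1) ω)
  v_zero : ∀ k ω, v k 0 ω = g k ω
  tdescent : ∀ k ω, ∀ i < G k,
    IsTDescentRun f (x k ω) (v k i ω) (gridRadius (G k) i) (T k)
      (fun t => tIter k i t ω) (fun t => tSub k i t ω)
  ndescent : ∀ k ω, ∀ i < G k,
    IsNDescentRun f (x k ω) (tIter k i (T k) ω) (gridRadius (G k) i) (T k)
      (fun t => nIter k i t ω) (fun t => nSub k i t ω) (fun t => radius k i t ω)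
      (fun t => ξ k i t ω) (fun t => θ k i t ω)
  v_succ : ∀ k ω, ∀ i < G k, v k (i + 1) ω = nIter k i (T k) ω
  x_succ_mem : ∀ k ω, x (k + 1) ω ∈
    linesearchCandidates (x k ω) (max ‖g k ω‖ (c₀ * ‖g₀‖)) (G k) (fun i => v k i ω)
  x_succ_min : ∀ k ω, ∀ z ∈
    linesearchCandidates (x k ω) (max ‖g k ω‖ (c₀ * ‖g₀‖)) (G k) (fun i => v k i ω),
    f (x (k + 1) ω) ≤ f z
  -- at the random points sampled by `NDescent`, the subgradient returned by the oracle is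
  -- (almost surely) the gradient
  nSub_eq_gradient : ∀ k, ∀ i < G k, ∀ t < T k, ∀ᵐ ω ∂P,
    NoDescent f (x k ω) (nIter k i t ω) (gridRadius (G k) i) →
    DifferentiableAt ℝ f (samplePoint (x k ω) (nIter k i t ω) (gridRadius (G k) i)
      (radius k i t ω) (ξ k i t ω) (θ k i t ω)) →
    nSub k i t ω = gradient f (samplePoint (x k ω) (nIter k i t ω) (gridRadius (G k) i)
      (radius k i t ω) (ξ k i t ω) (θ k i t ω))
  -- everything that is chosen before a sampling is determined by the history at that moment
  measurable_x : ∀ k, Measurable[hist (drawIndex k 0 0)] (x k)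
  measurable_g : ∀ k, Measurable[hist (drawIndex k 0 0)] (g k)
  measurable_tIter : ∀ k, ∀ i < G k, ∀ t ≤ T k, Measurable[hist (drawIndex k i 0)] (tIter k i t)
  measurable_nIter : ∀ k, ∀ i < G k, ∀ t ≤ T k, Measurable[hist (drawIndex k i t)] (nIter k i t)
  measurable_radius : ∀ k, ∀ i < G k, ∀ t < T k, Measurable[hist (drawIndex k i t)] (radius k i t)
  -- the sampling: the noise is fresh, and has the uniform laws on the unit ball and on `[0, 1]`
  measurable_ξ : ∀ k i t, Measurable (ξ k i t)
  measurable_θ : ∀ k i t, Measurable (θ k i t)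
  uniform_ξ : ∀ k i t, pdf.IsUniform (ξ k i t) (Metric.ball 0 1) P volume
  uniform_θ : ∀ k i t, pdf.IsUniform (θ k i t) (Set.Icc 0 1) P volume
  indep_ξ_θ : ∀ k i t, IndepFun (ξ k i t) (θ k i t) P
  indep_hist : ∀ k i t, Indep (hist (drawIndex k i t))
    (MeasurableSpace.comap (fun ω => (ξ k i t ω, θ k i t ω)) inferInstance) P

end

open scoped InnerProductSpace NNReal ENNReal

/-! Suppose that a limit point `xbar` is not critical. Its subdifferential is compact and convex,
hence strictly separated from `0` by a half-space, and the same half-space contains all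
subdifferentials on a ball `B_ε(xbar)` (`exists_uniform_separation`). Starting at `x_k` close to
`xbar`, with trial radii up to a fixed `σ = 2⁻ᵐ < ε/2`, the inner loops only take convex
combinations of `g_k` with subgradients from that ball. All their vectors stay in the half-space, so
they have norm at least some fixed `δ > 0` (`iterates_mem_of_convex`).

If the call of `NDescent` at radius `σ` ends because descent was achieved, the resulting point
passes the trust region test once `Lσ ≤ δ`, and `f` drops by at least `σδ/8` (`f_succ_le_sub`). As
`f(x_k)` is nonincreasing and bounded below, this happens only finitely often. It remains to show
that, for fixed `σ` and `δ`, almost surely only finitely many calls exhaust their budget without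
descent, with a vector of norm at least `δ`.

This is the probabilistic part. Rademacher's theorem and Fubini make `f` differentiable almost
surely at the sampled point, so the oracle returns the gradient there. If the step along `-a` fails
to descend, the fundamental theorem of calculus on the perturbed segment shows that the mean of `⟪a,
∇f⟫` is at most `‖a‖²/2`. Passing to the shortest vector of the segment therefore contracts the
expected squared norm, restricted to the stuck event, by the factor `1 - δ²/(16L²)`
(`setIntegral_norm_sq_succ_le`). Since that norm is at least `δ` on the event, Markov's inequality
gives a probability geometrically small in `T_k ≥ k`, and Borel–Cantelli concludes
(`ae_eventually_notMem_stuck`). -/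

/-- In finite dimension, the convex hull of a compact set is compact (by Carathéodory). -/
theorem isCompact_convexHull_of_finiteDimensional {E : Type*} [NormedAddCommGroup E]
    [NormedSpace ℝ E] [FiniteDimensional ℝ E] {s : Set E} (hs : IsCompact s) :
    IsCompact (convexHull ℝ s) := by
  rcases s.eq_empty_or_nonempty with rfl | ⟨z₀, hz₀⟩
  · simp
  set n := Module.finrank ℝ E + 1
  have hcont : Continuous fun q : (Fin n → ℝ) × (Fin n → E) => ∑ i, q.1 i • q.2 i := by fun_prop
  have himg : convexHull ℝ s = (fun q : (Fin n → ℝ) × (Fin n → E) => ∑ i, q.1 i • q.2 i) ''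
      (stdSimplex ℝ (Fin n) ×ˢ Set.univ.pi fun _ => s) := by
    ext y
    constructor
    · intro hy
      obtain ⟨ι, _, z, w, hz, hind, hw, hw1, rfl⟩ := eq_pos_convex_span_of_mem_convexHull hy
      have hcard : Fintype.card ι ≤ Fintype.card (Fin n) := by
        rw [Fintype.card_fin]
        exact hind.card_le_finrank_succ.trans
          (Nat.succ_le_succ (Submodule.finrank_le _))
      obtain ⟨e⟩ := Function.Embedding.nonempty_of_card_le hcard
      -- Carathéodory may need fewer than `n` points; the unused slots get weight `0` and the dummy
      -- point `z₀`.
      refine ⟨(Function.extend e w 0, Function.extend e z fun _ => z₀), ⟨⟨?_, ?_⟩, ?_⟩, ?_⟩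
      · intro i
        by_cases hi : ∃ j, e j = i
        · obtain ⟨j, rfl⟩ := hi
          simpa [e.injective.extend_apply] using (hw j).le
        · simp [Function.extend_apply' _ _ _ hi]
      · rw [← hw1, ← Fintype.sum_of_injective e e.injective w]
        · intro i hi
          exact Function.extend_apply' _ _ _ (by simpa using hi)
        · intro j
          simp [e.injective.extend_apply]
      · intro i _
        by_cases hi : ∃ j, e j = i
        · obtain ⟨j, rfl⟩ := hi
          simpa [e.injective.extend_apply] using hz ⟨j, rfl⟩
        · simpa [Function.extend_apply' _ _ _ hi] using hz₀
      · refine (Fintype.sum_of_injective e e.injective _ _ ?_ ?_).symm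
        · intro i hi
          have hi' : ¬ ∃ j, e j = i := by simpa using hi
          simp [Function.extend_apply' _ _ _ hi']
        · intro j
          simp [e.injective.extend_apply]
    · rintro ⟨⟨w, z⟩, ⟨⟨hw, hw1⟩, hz⟩, rfl⟩
      exact (convex_convexHull ℝ s).sum_mem (fun i _ => hw i) hw1
        fun i _ => subset_convexHull ℝ s (hz i trivial)
  rw [himg]
  exact ((isCompact_stdSimplex ℝ (Fin n)).prod (isCompact_univ_pi fun _ => hs)).image hcont

/-! ### Clarke subdifferentials: bounds, compactness, separation from the origin -/

section Clarke

variable {d : ℕ} {f : EuclideanSpace ℝ (Fin d) → ℝ}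

theorem norm_gradient_le_of_lipschitzOnWith {L : ℝ≥0} {U : Set (EuclideanSpace ℝ (Fin d))}
    {y : EuclideanSpace ℝ (Fin d)} (hU : U ∈ 𝓝 y) (hL : LipschitzOnWith L f U) :
    ‖gradient f y‖ ≤ L := by
  rw [gradient, LinearIsometryEquiv.norm_map]
  exact norm_fderiv_le_of_lipschitzOn ℝ hU hL

/-- Closed convex sets survive both operations in the definition, limits and convex hulls. It is
applied to balls (norm bounds) and to half-spaces (separation). -/
theorem clarkeSubdifferential_subset {U C : Set (EuclideanSpace ℝ (Fin d))}
    {y : EuclideanSpace ℝ (Fin d)} (hU : U ∈ 𝓝 y) (hC : Convex ℝ C) (hC' : IsClosed C)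
    (h : ∀ p ∈ U, DifferentiableAt ℝ f p → gradient f p ∈ C) :
    clarkeSubdifferential f y ⊆ C := by
  refine convexHull_min ?_ hC
  rintro v ⟨p, hp, hd, hv⟩
  refine hC'.mem_of_tendsto hv ?_
  filter_upwards [hp.eventually hU] with n hn using h _ hn (hd n)

theorem norm_le_of_mem_clarkeSubdifferential {L : ℝ≥0} {U : Set (EuclideanSpace ℝ (Fin d))}
    {y v : EuclideanSpace ℝ (Fin d)} (hU : U ∈ 𝓝 y) (hL : LipschitzOnWith L f U)
    (hv : v ∈ clarkeSubdifferential f y) : ‖v‖ ≤ L := by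
  have h := clarkeSubdifferential_subset (f := f) (interior_mem_nhds.2 hU)
    (convex_closedBall (0 : EuclideanSpace ℝ (Fin d)) (L : ℝ)) Metric.isClosed_closedBall
    (fun p hp _ => by
      simpa using norm_gradient_le_of_lipschitzOnWith (mem_interior_iff_mem_nhds.1 hp) hL) hv
  simpa using h

/-- The set of limiting gradients is compact. -/
theorem isCompact_limitingGradients (hf : LocallyLipschitz f) (x : EuclideanSpace ℝ (Fin d)) :
    IsCompact {v | ∃ p : ℕ → EuclideanSpace ℝ (Fin d), Tendsto p atTop (𝓝 x) ∧
      (∀ n, DifferentiableAt ℝ f (p n)) ∧ Tendsto (fun n => gradient f (p n)) atTop (𝓝 v)} := by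
  obtain ⟨L, U, hU, hL⟩ := hf x
  refine Metric.isCompact_of_isClosed_isBounded ?_ ?_
  · have : {v | ∃ p : ℕ → EuclideanSpace ℝ (Fin d), Tendsto p atTop (𝓝 x) ∧
        (∀ n, DifferentiableAt ℝ f (p n)) ∧ Tendsto (fun n => gradient f (p n)) atTop (𝓝 v)} =
        (fun v => (x, v)) ⁻¹'
          closure ((fun p => (p, gradient f p)) '' {p | DifferentiableAt ℝ f p}) := by
      ext v
      rw [Set.mem_preimage, mem_closure_iff_seq_limit]
      constructor
      · rintro ⟨p, hp, hd, hv⟩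
        exact ⟨fun n => (p n, gradient f (p n)), fun n => ⟨p n, hd n, rfl⟩, hp.prodMk_nhds hv⟩
      · rintro ⟨q, hq, hlim⟩
        choose p hd hpq using hq
        obtain rfl : (fun n => (p n, gradient f (p n))) = q := funext hpq
        rw [nhds_prod_eq, tendsto_prod_iff'] at hlim
        exact ⟨p, hlim.1, hd, hlim.2⟩
    rw [this]
    exact isClosed_closure.preimage (by fun_prop)
  · refine (Metric.isBounded_closedBall (x := 0) (r := (L : ℝ))).subset ?_
    intro v hv
    simpa using norm_le_of_mem_clarkeSubdifferential hU hL (subset_convexHull ℝ _ hv)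

/-- Near a point that is not Clarke critical, the subdifferentials lie uniformly in an open
half-space which does not contain the origin. -/
theorem exists_uniform_separation (hf : LocallyLipschitz f) {x : EuclideanSpace ℝ (Fin d)}
    (hx : ¬ IsClarkeCritical f x) :
    ∃ w : EuclideanSpace ℝ (Fin d), ∃ u > 0, ∃ ε > 0, ∀ y ∈ Metric.ball x ε,
      ∀ v ∈ clarkeSubdifferential f y, u ≤ ⟪w, v⟫_ℝ := by
  have hcpt := isCompact_limitingGradients hf x
  obtain ⟨φ, u, hu, hφ⟩ := geometric_hahn_banach_point_closed (convex_convexHull ℝ _)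
    (isCompact_convexHull_of_finiteDimensional hcpt).isClosed hx
  rw [map_zero] at hu
  set w := (InnerProductSpace.toDual ℝ (EuclideanSpace ℝ (Fin d))).symm φ
  have hw : ∀ v, φ v = ⟪w, v⟫_ℝ := fun v => by simp [w]
  have key : ∃ ε > 0, ∀ p ∈ Metric.ball x ε, DifferentiableAt ℝ f p →
      gradient f p ∈ {v | u ≤ ⟪w, v⟫_ℝ} := by
    -- Otherwise gradients violating the bound at points tending to `x` would, by compactness,
    -- accumulate at a limiting gradient on the wrong side of the hyperplane.
    by_contra! hcon
    choose p hp hd hpu using fun n : ℕ => hcon (1 / ((n : ℝ) + 1)) (by positivity)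
    have hlim : Tendsto p atTop (𝓝 x) := by
      rw [tendsto_iff_dist_tendsto_zero]
      exact squeeze_zero (fun _ => dist_nonneg) (fun n => (Metric.mem_ball.1 (hp n)).le)
        tendsto_one_div_add_atTop_nhds_zero_nat
    obtain ⟨L, U, hU, hL⟩ := hf x
    have hbd : ∃ᶠ n in atTop, gradient f (p n) ∈ Metric.closedBall 0 (L : ℝ) := by
      refine Eventually.frequently ?_
      filter_upwards [hlim.eventually (interior_mem_nhds.2 hU)] with n hn
      simpa using norm_gradient_le_of_lipschitzOnWith (mem_interior_iff_mem_nhds.1 hn) hL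
    obtain ⟨v, -, ψ, hψ, hv⟩ :=
      (isCompact_closedBall (0 : EuclideanSpace ℝ (Fin d)) (L : ℝ)).tendsto_subseq' hbd
    have h1 : u < φ v := hφ v (subset_convexHull ℝ _
      ⟨p ∘ ψ, hlim.comp hψ.tendsto_atTop, fun n => hd _, hv⟩)
    have h2 : φ v ≤ u := by
      refine le_of_tendsto ((φ.continuous.tendsto v).comp hv) (Eventually.of_forall fun n => ?_)
      have := hpu (ψ n)
      simp only [Set.mem_ofPred_eq, not_le] at this
      simpa [hw] using this.le
    exact absurd h1 h2.not_gt
  obtain ⟨ε, hε, h⟩ := key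
  refine ⟨w, u, hu, ε, hε, fun y hy v hv => ?_⟩
  exact clarkeSubdifferential_subset (Metric.isOpen_ball.mem_nhds hy)
    (convex_halfSpace_ge ⟨fun a b => inner_add_right _ _ _, fun c a => by
      simp [inner_smul_right]⟩ u)
    (isClosed_le continuous_const (by fun_prop)) h hv

end Clarke

/-! ### Deterministic properties of the inner loops -/

section Descent

variable {d : ℕ} {f : EuclideanSpace ℝ (Fin d) → ℝ} {x g : EuclideanSpace ℝ (Fin d)} {σ : ℝ}
  {T : ℕ} {a s : ℕ → EuclideanSpace ℝ (Fin d)}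

theorem dist_normalizedStep_le (x g : EuclideanSpace ℝ (Fin d)) (hσ : 0 ≤ σ) :
    dist (normalizedStep x g σ) x ≤ σ := by
  rw [normalizedStep, dist_eq_norm, sub_sub_cancel_left, norm_neg, norm_smul, Real.norm_eq_abs,
    abs_of_nonneg (by positivity)]
  rcases eq_or_ne ‖g‖ 0 with h | h
  · simp [h, hσ]
  · rw [div_mul_cancel₀ _ h]

theorem dist_samplePoint_le (x g : EuclideanSpace ℝ (Fin d)) (hσ : 0 ≤ σ) (r : ℝ)
    (ξ : EuclideanSpace ℝ (Fin d)) {θ : ℝ} (hθ : θ ∈ Set.Icc (0 : ℝ) 1) :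
    dist (samplePoint x g σ r ξ θ) x ≤ σ := by
  rw [samplePoint, dist_lineMap_left, dist_comm, Real.norm_of_nonneg hθ.1]
  have := dist_normalizedStep_le x (g + r • ξ) hσ
  nlinarith [hθ.1, hθ.2, dist_nonneg (x := normalizedStep x (g + r • ξ) σ) (y := x)]

theorem IsShortestInSegment.mem_of_convex {C : Set (EuclideanSpace ℝ (Fin d))}
    {a b z : EuclideanSpace ℝ (Fin d)} (h : IsShortestInSegment a b z) (hC : Convex ℝ C)
    (ha : a ∈ C) (hb : b ∈ C) : z ∈ C :=
  hC.segment_subset ha hb h.1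

/-- Each new iterate lies on a segment joining the old one to a subgradient taken within distance
`σ` of `x`. -/
theorem IsTDescentRun.mem_of_convex (h : IsTDescentRun f x g σ T a s) (hσ : 0 ≤ σ)
    {C : Set (EuclideanSpace ℝ (Fin d))} (hC : Convex ℝ C) (hg : g ∈ C)
    (hsub : ∀ y ∈ Metric.closedBall x σ, clarkeSubdifferential f y ⊆ C) :
    ∀ t ≤ T, a t ∈ C := by
  intro t
  induction t with
  | zero => intro _; rwa [h.init]
  | succ t ih =>
    intro ht
    by_cases hd : NoDescent f x (a t) σ
    · exact (h.step t ht hd).mem_of_convex hC (ih (by omega))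
        (hsub _ (dist_normalizedStep_le _ _ hσ) (h.choose_mem t ht hd))
    · rw [h.frozen t ht hd]; exact ih (by omega)

theorem IsNDescentRun.mem_of_convex {r : ℕ → ℝ} {ξ : ℕ → EuclideanSpace ℝ (Fin d)} {θ : ℕ → ℝ}
    (h : IsNDescentRun f x g σ T a s r ξ θ) (hσ : 0 ≤ σ)
    (hθ : ∀ t < T, θ t ∈ Set.Icc (0 : ℝ) 1)
    {C : Set (EuclideanSpace ℝ (Fin d))} (hC : Convex ℝ C) (hg : g ∈ C)
    (hsub : ∀ y ∈ Metric.closedBall x σ, clarkeSubdifferential f y ⊆ C) :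
    ∀ t ≤ T, a t ∈ C := by
  intro t
  induction t with
  | zero => intro _; rwa [h.init]
  | succ t ih =>
    intro ht
    by_cases hd : NoDescent f x (a t) σ
    · exact (h.step t ht hd).mem_of_convex hC (ih (by omega))
        (hsub _ (dist_samplePoint_le _ _ hσ _ _ (hθ t ht)) (h.choose_mem t ht hd))
    · rw [h.frozen t ht hd]; exact ih (by omega)

/-- The minimizer is compared with the point of parameter `l` on the segment; `l` stays free so that
it can be chosen deterministically later. -/
theorem IsShortestInSegment.norm_sq_le {a b z : EuclideanSpace ℝ (Fin d)}
    (h : IsShortestInSegment a b z) {L : ℝ} (ha : ‖a‖ ≤ L) (hb : ‖b‖ ≤ L) {l : ℝ} (hl : 0 ≤ l)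
    (hl1 : l ≤ 1) :
    ‖z‖ ^ 2 ≤ ‖a‖ ^ 2 - 2 * l * (‖a‖ ^ 2 - ⟪a, b⟫_ℝ) + 4 * l ^ 2 * L ^ 2 := by
  have h1 : ‖z‖ ≤ ‖a + l • (b - a)‖ := by
    refine h.2 _ ?_
    rw [segment_eq_image']
    exact ⟨l, ⟨hl, hl1⟩, rfl⟩
  have h2 : ‖z‖ ^ 2 ≤ ‖a + l • (b - a)‖ ^ 2 := pow_le_pow_left₀ (norm_nonneg _) h1 2
  have h3 : ‖b - a‖ ^ 2 ≤ (2 * L) ^ 2 :=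
    pow_le_pow_left₀ (norm_nonneg _) ((norm_sub_le _ _).trans (by linarith)) 2
  rw [norm_add_sq_real, inner_smul_right, inner_sub_right, real_inner_self_eq_norm_sq, norm_smul,
    mul_pow, Real.norm_eq_abs, sq_abs] at h2
  nlinarith [sq_nonneg l, mul_le_mul_of_nonneg_left h3 (sq_nonneg l)]

/-- A stopped loop stays frozen, so an active moment is preceded only by active ones; this makes the
stuck events decreasing in `t`. -/
theorem IsNDescentRun.noDescent_of_succ {r : ℕ → ℝ} {ξ : ℕ → EuclideanSpace ℝ (Fin d)}
    {θ : ℕ → ℝ} (h : IsNDescentRun f x g σ T a s r ξ θ) {t : ℕ} (ht : t < T)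
    (hd : NoDescent f x (a (t + 1)) σ) :
    NoDescent f x (a t) σ ∧ ‖a (t + 1)‖ ≤ ‖a t‖ := by
  by_cases hd' : NoDescent f x (a t) σ
  · exact ⟨hd', (h.step t ht hd').2 _ (left_mem_segment ℝ _ _)⟩
  · rw [h.frozen t ht hd'] at hd
    exact absurd hd hd'

end Descent

/-! ### Differentiability and mean gradient along the sampled segment -/

section Sampling

variable {d : ℕ} {f : EuclideanSpace ℝ (Fin d) → ℝ}

theorem LocallyLipschitz.exists_lipschitzOnWith_closedBall (hf : LocallyLipschitz f) (ρ : ℝ) :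
    ∃ L : ℝ≥0, LipschitzOnWith L f (Metric.closedBall 0 ρ) :=
  hf.locallyLipschitzOn.exists_lipschitzOnWith_of_compact (isCompact_closedBall _ _)

theorem LocallyLipschitz.ae_differentiableAt_volume (hf : LocallyLipschitz f) :
    ∀ᵐ y, DifferentiableAt ℝ f y := by
  have h : ∀ᵐ y, ∀ n : ℕ, y ∈ Metric.closedBall (0 : EuclideanSpace ℝ (Fin d)) n →
      DifferentiableWithinAt ℝ f (Metric.closedBall 0 n) y := by
    rw [ae_all_iff]
    intro n
    obtain ⟨L, hL⟩ := hf.exists_lipschitzOnWith_closedBall n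
    exact hL.ae_differentiableWithinAt_of_mem
  filter_upwards [h] with y hy
  obtain ⟨n, hn⟩ := exists_nat_gt ‖y‖
  exact (hy n (by simpa using hn.le)).differentiableAt
    (mem_of_superset (Metric.isOpen_ball.mem_nhds (by simpa using hn)) Metric.ball_subset_closedBall)

/-- Almost every line through `x` consists almost everywhere of differentiability points. -/
theorem ae_ae_differentiableAt_line (hf : LocallyLipschitz f) (x : EuclideanSpace ℝ (Fin d)) :
    ∀ᵐ z : EuclideanSpace ℝ (Fin d), ∀ᵐ u : ℝ, DifferentiableAt ℝ f (x - u • z) := by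
  -- After exchanging the quantifiers by Fubini, `u ≠ 0` is fixed and `z ↦ x - u • z` pulls null
  -- sets back to null sets, so Rademacher's theorem applies.
  rw [Measure.ae_ae_comm]
  · filter_upwards [Measure.ae_ne volume (0 : ℝ)] with u hu
    have h1 : Measure.QuasiMeasurePreserving
        (fun z : EuclideanSpace ℝ (Fin d) => u • z) volume volume := by
      refine ⟨by fun_prop, ?_⟩
      rw [Measure.map_addHaar_smul _ hu]
      exact Measure.smul_absolutelyContinuous
    have h2 : Measure.QuasiMeasurePreserving
        (fun z : EuclideanSpace ℝ (Fin d) => x - z) volume volume :=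
      quasiMeasurePreserving_sub_left volume x
    exact (h2.comp h1).ae hf.ae_differentiableAt_volume
  · exact (measurableSet_of_differentiableAt ℝ f).preimage (by fun_prop)

theorem samplePoint_eq (x g : EuclideanSpace ℝ (Fin d)) (σ r : ℝ)
    (ξ : EuclideanSpace ℝ (Fin d)) (θ : ℝ) :
    samplePoint x g σ r ξ θ = x - (θ * (σ / ‖g + r • ξ‖)) • (g + r • ξ) := by
  rw [samplePoint, normalizedStep, AffineMap.lineMap_apply]
  simp only [vsub_eq_sub, vadd_eq_add, sub_sub_cancel_left, smul_neg, smul_smul]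
  abel

theorem ae_ae_differentiableAt_samplePoint (hf : LocallyLipschitz f)
    (x g : EuclideanSpace ℝ (Fin d)) {σ r : ℝ} (hσ : 0 < σ) (hr : 0 < r) :
    ∀ᵐ ξ : EuclideanSpace ℝ (Fin d), g + r • ξ ≠ 0 →
      ∀ᵐ θ : ℝ, DifferentiableAt ℝ f (samplePoint x g σ r ξ θ) := by
  have h1 : Measure.QuasiMeasurePreserving
      (fun z : EuclideanSpace ℝ (Fin d) => r • z) volume volume := by
    refine ⟨by fun_prop, ?_⟩
    rw [Measure.map_addHaar_smul _ hr.ne']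
    exact Measure.smul_absolutelyContinuous
  have h2 : Measure.QuasiMeasurePreserving
      (fun z : EuclideanSpace ℝ (Fin d) => g + z) volume volume :=
    quasiMeasurePreserving_add_left volume g
  filter_upwards [(h2.comp h1).ae (ae_ae_differentiableAt_line hf x)] with ξ hξ hne
  have hc : σ / ‖g + r • ξ‖ ≠ 0 := (div_pos hσ (norm_pos_iff.2 hne)).ne'
  have h3 : Measure.QuasiMeasurePreserving
      (fun θ : ℝ => θ * (σ / ‖g + r • ξ‖)) volume volume := by
    refine ⟨by fun_prop, ?_⟩
    rw [Real.map_volume_mul_right hc]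
    exact Measure.smul_absolutelyContinuous
  filter_upwards [h3.ae hξ] with θ hθ
  rw [samplePoint_eq]
  exact hθ

theorem measurable_gradient : Measurable (gradient f) := by
  unfold gradient
  exact ((InnerProductSpace.toDual ℝ (EuclideanSpace ℝ (Fin d))).symm.continuous.measurable).comp
    (measurable_fderiv ℝ f)

theorem norm_normalize_sub_normalize_le {E : Type*} [NormedAddCommGroup E] [NormedSpace ℝ E]
    {a z : E} (ha : a ≠ 0) (hz : z ≠ 0) :
    ‖(1 / ‖z‖) • z - (1 / ‖a‖) • a‖ ≤ 2 * ‖z - a‖ / ‖a‖ := by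
  have ha' : 0 < ‖a‖ := norm_pos_iff.2 ha
  have hz' : 0 < ‖z‖ := norm_pos_iff.2 hz
  rw [le_div_iff₀ ha']
  have h : ‖a‖ • ((1 / ‖z‖) • z - (1 / ‖a‖) • a) = ((‖a‖ - ‖z‖) * (1 / ‖z‖)) • z + (z - a) := by
    rw [smul_sub, smul_smul, smul_smul, sub_mul, sub_smul, mul_one_div_cancel ha'.ne',
      mul_one_div_cancel hz'.ne']
    simp
  calc ‖(1 / ‖z‖) • z - (1 / ‖a‖) • a‖ * ‖a‖
      = ‖‖a‖ • ((1 / ‖z‖) • z - (1 / ‖a‖) • a)‖ := by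
        rw [norm_smul, norm_norm, mul_comm]
    _ ≤ ‖((‖a‖ - ‖z‖) * (1 / ‖z‖)) • z‖ + ‖z - a‖ := by rw [h]; exact norm_add_le _ _
    _ = |‖a‖ - ‖z‖| + ‖z - a‖ := by
        rw [norm_smul, Real.norm_eq_abs, abs_mul, abs_of_pos (one_div_pos.2 hz'), mul_assoc,
          one_div_mul_cancel hz'.ne', mul_one]
    _ ≤ 2 * ‖z - a‖ := by
        have := abs_norm_sub_norm_le a z
        rw [norm_sub_rev] at this
        linarith

theorem continuous_samplePoint (x a : EuclideanSpace ℝ (Fin d)) (σ r : ℝ)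
    (ξ : EuclideanSpace ℝ (Fin d)) : Continuous (samplePoint x a σ r ξ) := by
  simp only [funext (samplePoint_eq x a σ r ξ)]
  fun_prop

/-- The fundamental theorem of calculus along the sampled segment. -/
theorem setIntegral_inner_gradient_samplePoint_eq {L : ℝ≥0} {U : Set (EuclideanSpace ℝ (Fin d))}
    (hL : LipschitzOnWith L f U) {x a : EuclideanSpace ℝ (Fin d)} {σ r : ℝ} (hσ : 0 ≤ σ)
    (hU : Metric.closedBall x σ ⊆ U) {ξ : EuclideanSpace ℝ (Fin d)}
    (hdiff : ∀ᵐ θ : ℝ, DifferentiableAt ℝ f (samplePoint x a σ r ξ θ)) :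
    ∫ θ in Set.Icc (0 : ℝ) 1, ⟪gradient f (samplePoint x a σ r ξ θ),
      (σ / ‖a + r • ξ‖) • (a + r • ξ)⟫_ℝ = f x - f (normalizedStep x (a + r • ξ) σ) := by
  set p := normalizedStep x (a + r • ξ) σ with hp
  have hpx : p - x = -((σ / ‖a + r • ξ‖) • (a + r • ξ)) := by simp [hp, normalizedStep]
  have hLip : LipschitzOnWith (L * nndist x p) (fun θ : ℝ => f (AffineMap.lineMap x p θ))
      (Set.uIcc 0 1) := by
    refine hL.comp (lipschitzWith_lineMap x p).lipschitzOnWith ?_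
    intro θ hθ
    rw [Set.uIcc_of_le zero_le_one] at hθ
    exact hU (dist_samplePoint_le x a hσ r ξ hθ)
  -- Along the segment `f` is Lipschitz, hence absolutely continuous, so differentiability almost
  -- everywhere suffices.
  have hftc := hLip.absolutelyContinuousOnInterval.integral_deriv_eq_sub
  rw [intervalIntegral.integral_of_le zero_le_one, ← integral_Icc_eq_integral_Ioc] at hftc
  simp only [AffineMap.lineMap_apply_one, AffineMap.lineMap_apply_zero] at hftc
  rw [← neg_sub, ← hftc, ← integral_neg]
  refine integral_congr_ae (ae_restrict_of_ae ?_)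
  filter_upwards [hdiff] with θ hθ
  have hd : HasDerivAt (fun θ : ℝ => f (AffineMap.lineMap x p θ))
      (fderiv ℝ f (AffineMap.lineMap x p θ) (p - x)) θ :=
    HasFDerivAt.comp_hasDerivAt θ (DifferentiableAt.hasFDerivAt hθ) AffineMap.hasDerivAt_lineMap
  rw [hd.deriv, hpx, map_neg, neg_neg, gradient, InnerProductSpace.toDual_symm_apply]
  rfl

/-- If the step along `-a` does not achieve descent, the gradient at the sampled point is on
average far from satisfying `⟪∇f, a⟫ ≥ ‖a‖²`. -/
theorem setIntegral_inner_gradient_samplePoint_le {L : ℝ≥0} {U : Set (EuclideanSpace ℝ (Fin d))}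
    (hL : LipschitzOnWith L f U) {x a : EuclideanSpace ℝ (Fin d)} {σ r : ℝ} (hσ : 0 < σ)
    (hσ1 : σ ≤ 1) (hU : ∀ y ∈ Metric.closedBall x σ, U ∈ 𝓝 y) (hd : NoDescent f x a σ)
    (hsmall : 16 * L * σ ≤ ‖a‖) (hr : 0 < r) (hra : r < σ * ‖a‖)
    {ξ : EuclideanSpace ℝ (Fin d)} (hξ : ‖ξ‖ < 1)
    (hdiff : ∀ᵐ θ : ℝ, DifferentiableAt ℝ f (samplePoint x a σ r ξ θ)) :
    ∫ θ in Set.Icc (0 : ℝ) 1, ⟪a, gradient f (samplePoint x a σ r ξ θ)⟫_ℝ ≤ ‖a‖ ^ 2 / 2 := by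
  have ha : 0 < ‖a‖ := hd.1
  have hne : a ≠ 0 := norm_pos_iff.1 ha
  have hUsub : Metric.closedBall x σ ⊆ U := fun y hy => mem_of_mem_nhds (hU y hy)
  set z := a + r • ξ with hz
  have hza : ‖z - a‖ ≤ σ * ‖a‖ := by
    rw [hz, add_sub_cancel_left, norm_smul, Real.norm_of_nonneg hr.le]
    nlinarith [norm_nonneg ξ]
  have hza' : ‖z - a‖ < ‖a‖ := by
    rw [hz, add_sub_cancel_left, norm_smul, Real.norm_of_nonneg hr.le]
    nlinarith [norm_nonneg ξ]
  have hzne : z ≠ 0 := by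
    intro h
    rw [h, zero_sub, norm_neg] at hza'
    exact lt_irrefl _ hza'
  obtain ⟨e, he⟩ : ∃ e, e = (1 / ‖z‖) • z := ⟨_, rfl⟩
  obtain ⟨e₀, he₀⟩ : ∃ e₀, e₀ = (1 / ‖a‖) • a := ⟨_, rfl⟩
  -- The bound `r < σ‖a‖` on the radius is what keeps the perturbed direction within `2σ` of the
  -- original one.
  have hee : ‖e - e₀‖ ≤ 2 * σ := by
    rw [he, he₀]
    refine (norm_normalize_sub_normalize_le hne hzne).trans ?_
    rw [div_le_iff₀ ha]
    linarith
  have hftc := setIntegral_inner_gradient_samplePoint_eq hL hσ.le hUsub hdiff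
  rw [← hz] at hftc
  have hsz : (σ / ‖z‖) • z = σ • e := by rw [he, smul_smul, mul_one_div]
  have hstep : f (normalizedStep x a σ) - f (normalizedStep x z σ) ≤ L * (σ * (2 * σ)) := by
    have h1 := hL.dist_le_mul (normalizedStep x a σ) (hUsub (dist_normalizedStep_le x a hσ.le))
      (normalizedStep x z σ) (hUsub (dist_normalizedStep_le x z hσ.le))
    have h2 : dist (normalizedStep x a σ) (normalizedStep x z σ) ≤ σ * (2 * σ) := by
      have : normalizedStep x a σ - normalizedStep x z σ = σ • (e - e₀) := by
        rw [smul_sub, he₀, smul_smul, mul_one_div, ← hsz, normalizedStep, normalizedStep]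
        abel
      rw [dist_eq_norm, this, norm_smul, Real.norm_of_nonneg hσ.le]
      gcongr
    exact (le_abs_self _).trans (h1.trans (by gcongr))
  have hmeas : ∀ w : EuclideanSpace ℝ (Fin d), AEStronglyMeasurable
      (fun θ => ⟪gradient f (samplePoint x a σ r ξ θ), w⟫_ℝ)
      volume := fun w =>
    ((measurable_gradient.comp (continuous_samplePoint x a σ r ξ).measurable).inner_const
      ).aestronglyMeasurable
  have hgrad : ∀ θ ∈ Set.Icc (0 : ℝ) 1, ‖gradient f (samplePoint x a σ r ξ θ)‖ ≤ L := fun θ hθ =>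
    norm_gradient_le_of_lipschitzOnWith (hU _ (dist_samplePoint_le x a hσ.le r ξ hθ)) hL
  have hint : ∀ w : EuclideanSpace ℝ (Fin d), IntegrableOn
      (fun θ => ⟪gradient f (samplePoint x a σ r ξ θ), w⟫_ℝ) (Set.Icc (0 : ℝ) 1) := fun w =>
    Measure.integrableOn_of_bounded (M := L * ‖w‖) (by simp) (hmeas w) (by
      filter_upwards [ae_restrict_mem measurableSet_Icc] with θ hθ
      exact (norm_inner_le_norm _ _).trans (by gcongr; exact hgrad θ hθ))
  have hptw : ∀ θ ∈ Set.Icc (0 : ℝ) 1, ⟪a, gradient f (samplePoint x a σ r ξ θ)⟫_ℝ ≤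
      ⟪gradient f (samplePoint x a σ r ξ θ), ‖a‖ • e⟫_ℝ + ‖a‖ * (L * (2 * σ)) := by
    intro θ hθ
    set v := gradient f (samplePoint x a σ r ξ θ)
    have h1 : a = ‖a‖ • e₀ := by rw [he₀, smul_smul, mul_one_div_cancel ha.ne', one_smul]
    have h2 : ⟪a, v⟫_ℝ = ‖a‖ * ⟪v, e₀⟫_ℝ := by
      conv_lhs => rw [real_inner_comm, h1, inner_smul_right]
    have h3 : ⟪v, e₀⟫_ℝ - ⟪v, e⟫_ℝ ≤ L * (2 * σ) := by
      rw [← inner_sub_right]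
      refine (real_inner_le_norm _ _).trans ?_
      rw [norm_sub_rev]
      exact mul_le_mul (hgrad θ hθ) hee (norm_nonneg _) L.2
    rw [h2, inner_smul_right]
    nlinarith
  have hmono : ∫ θ in Set.Icc (0 : ℝ) 1, ⟪a, gradient f (samplePoint x a σ r ξ θ)⟫_ℝ ≤
      (∫ θ in Set.Icc (0 : ℝ) 1, ⟪gradient f (samplePoint x a σ r ξ θ), ‖a‖ • e⟫_ℝ) +
        ‖a‖ * (L * (2 * σ)) := by
    have h1 : ∫ θ in Set.Icc (0 : ℝ) 1, (⟪gradient f (samplePoint x a σ r ξ θ), ‖a‖ • e⟫_ℝ +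
        ‖a‖ * (L * (2 * σ))) = (∫ θ in Set.Icc (0 : ℝ) 1,
          ⟪gradient f (samplePoint x a σ r ξ θ), ‖a‖ • e⟫_ℝ) + ‖a‖ * (L * (2 * σ)) := by
      rw [integral_add (hint _) (integrable_const _)]
      simp
    rw [← h1]
    refine setIntegral_mono_on ?_ ((hint _).add (integrable_const _)) measurableSet_Icc hptw
    simpa only [real_inner_comm] using hint a
  rw [hsz] at hftc
  simp only [inner_smul_right, integral_const_mul] at hftc hmono
  set I := ∫ θ in Set.Icc (0 : ℝ) 1, ⟪gradient f (samplePoint x a σ r ξ θ), e⟫_ℝ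
  have hI : I ≤ ‖a‖ / 8 + L * (2 * σ) := by
    have h1 := hd.2
    have : σ * I ≤ σ * (‖a‖ / 8 + L * (2 * σ)) := by
      rw [hftc]; linarith
    exact le_of_mul_le_mul_left this hσ
  -- The total is `‖a‖²/8 + 4Lσ‖a‖`, where the perturbation enters twice: in the endpoint and in the
  -- direction. With `16Lσ ≤ ‖a‖` this is at most `3‖a‖²/8`.
  nlinarith

end Sampling

/-! ### One random step: averaging over fresh noise -/

section OneStep

variable {d : ℕ} {f : EuclideanSpace ℝ (Fin d) → ℝ}

/-- The states `(x, a, r)` from which the normal descent loop makes a controlled step. -/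
def activeStates (f : EuclideanSpace ℝ (Fin d) → ℝ) (σ δ L ρ : ℝ) :
    Set (EuclideanSpace ℝ (Fin d) × EuclideanSpace ℝ (Fin d) × ℝ) :=
  {q | NoDescent f q.1 q.2.1 σ ∧ δ ≤ ‖q.2.1‖ ∧ ‖q.2.1‖ ≤ L ∧ 0 < q.2.2 ∧
    q.2.2 < σ * ‖q.2.1‖ ∧ ‖q.1‖ ≤ ρ}

theorem measurableSet_noDescent {α : Type*} [MeasurableSpace α] (hf : Continuous f) {σ : ℝ}
    {x a : α → EuclideanSpace ℝ (Fin d)} (hx : Measurable x) (ha : Measurable a) :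
    MeasurableSet {q | NoDescent f (x q) (a q) σ} := by
  have hs : Measurable fun q => normalizedStep (x q) (a q) σ := by
    unfold normalizedStep
    fun_prop
  exact (measurableSet_lt measurable_const ha.norm).inter
    (measurableSet_le ((hf.measurable.comp hx).sub (hf.measurable.comp hs))
      (measurable_const.mul ha.norm))

theorem measurableSet_activeStates (hf : Continuous f) (σ δ L ρ : ℝ) :
    MeasurableSet (activeStates f σ δ L ρ) := by
  refine (measurableSet_noDescent hf measurable_fst measurable_snd.fst).inter ?_
  have ha : Measurable fun q : EuclideanSpace ℝ (Fin d) × EuclideanSpace ℝ (Fin d) × ℝ =>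
      ‖q.2.1‖ := by fun_prop
  have hr : Measurable fun q : EuclideanSpace ℝ (Fin d) × EuclideanSpace ℝ (Fin d) × ℝ =>
      q.2.2 := by fun_prop
  exact (measurableSet_le measurable_const ha).inter <|
    (measurableSet_le ha measurable_const).inter <|
    (measurableSet_lt measurable_const hr).inter <|
    (measurableSet_lt hr (ha.const_mul σ)).inter <|
    measurableSet_le measurable_fst.norm measurable_const

/-- The sampled point as a function of the state and of the noise. -/
noncomputable def sampleMap (σ : ℝ) (q : (EuclideanSpace ℝ (Fin d) × EuclideanSpace ℝ (Fin d) × ℝ) ×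
    (EuclideanSpace ℝ (Fin d) × ℝ)) : EuclideanSpace ℝ (Fin d) :=
  samplePoint q.1.1 q.1.2.1 σ q.1.2.2 q.2.1 q.2.2

theorem measurable_sampleMap (σ : ℝ) : Measurable (sampleMap (d := d) σ) := by
  unfold sampleMap
  simp only [samplePoint_eq]
  fun_prop

theorem closedBall_mem_nhds_of_mem_closedBall {x y : EuclideanSpace ℝ (Fin d)} {ρ σ : ℝ}
    (hx : ‖x‖ ≤ ρ) (hσ : σ ≤ 1) (hy : y ∈ Metric.closedBall x σ) :
    Metric.closedBall 0 (ρ + 2) ∈ 𝓝 y := by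
  refine mem_of_superset (Metric.isOpen_ball.mem_nhds ?_) Metric.ball_subset_closedBall
  rw [mem_ball_zero_iff]
  rw [mem_closedBall_iff_norm] at hy
  have := norm_add_le x (y - x)
  rw [add_sub_cancel] at this
  linarith

theorem add_smul_ne_zero_of_lt {a ξ : EuclideanSpace ℝ (Fin d)} {r σ : ℝ} (hσ : σ ≤ 1)
    (hr : 0 < r) (hra : r < σ * ‖a‖) (hξ : ‖ξ‖ < 1) : a + r • ξ ≠ 0 := by
  intro h
  have h1 : ‖a‖ = r * ‖ξ‖ := by
    rw [eq_neg_of_add_eq_zero_left h, norm_neg, norm_smul, Real.norm_of_nonneg hr.le]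
  nlinarith [norm_nonneg ξ, norm_nonneg a]

variable {Ω : Type*} {m : MeasurableSpace Ω} [mΩ : MeasurableSpace Ω] {P : Measure Ω}
  {x a ξ : Ω → EuclideanSpace ℝ (Fin d)} {r θ : Ω → ℝ}

theorem map_uniform_Icc (hθ : pdf.IsUniform θ (Set.Icc 0 1) P volume) :
    P.map θ = volume.restrict (Set.Icc (0 : ℝ) 1) := by
  rw [hθ]
  simp [ProbabilityTheory.cond]

theorem ae_mem_Icc_of_isUniform (hθm : Measurable θ)
    (hθ : pdf.IsUniform θ (Set.Icc 0 1) P volume) : ∀ᵐ ω ∂P, θ ω ∈ Set.Icc (0 : ℝ) 1 := by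
  refine ae_of_ae_map hθm.aemeasurable ?_
  rw [map_uniform_Icc hθ]
  exact ae_restrict_mem measurableSet_Icc

theorem ae_norm_lt_one_of_isUniform (hξ : pdf.IsUniform ξ (Metric.ball 0 1) P volume) :
    ∀ᵐ z ∂(P.map ξ), ‖z‖ < 1 := by
  rw [hξ]
  have h : ∀ᵐ z ∂(volume.restrict (Metric.ball (0 : EuclideanSpace ℝ (Fin d)) 1)), ‖z‖ < 1 := by
    filter_upwards [ae_restrict_mem Metric.isOpen_ball.measurableSet] with z hz
    simpa using hz
  exact Measure.smul_absolutelyContinuous.ae_le h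

variable [IsProbabilityMeasure P]

/-- The noise is independent of the past `m`, and its two components of each other, so the joint law
factors. By Fubini the state can then be frozen while the noise is averaged. -/
theorem map_state_noise (hm : m ≤ mΩ)
    (hx : Measurable[m] x) (ha : Measurable[m] a) (hr : Measurable[m] r)
    (hξm : Measurable ξ) (hθm : Measurable θ) (hθ : pdf.IsUniform θ (Set.Icc 0 1) P volume)
    (hind : IndepFun ξ θ P)
    (hfresh : Indep m (MeasurableSpace.comap (fun ω => (ξ ω, θ ω)) inferInstance) P) :
    P.map (fun ω => ((x ω, a ω, r ω), (ξ ω, θ ω))) =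
      (P.map fun ω => (x ω, a ω, r ω)).prod
        ((P.map ξ).prod (volume.restrict (Set.Icc (0 : ℝ) 1))) := by
  have hD : Measurable[m] fun ω => (x ω, a ω, r ω) := hx.prodMk (ha.prodMk hr)
  have h1 : IndepFun (fun ω => (x ω, a ω, r ω)) (fun ω => (ξ ω, θ ω)) P := by
    rw [IndepFun_iff_Indep]
    exact indep_of_indep_of_le_left hfresh hD.comap_le
  rw [(indepFun_iff_map_prod_eq_prod_map_map (hD.mono hm le_rfl).aemeasurable
    (hξm.prodMk hθm).aemeasurable).1 h1,
    (indepFun_iff_map_prod_eq_prod_map_map hξm.aemeasurable hθm.aemeasurable).1 hind,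
    map_uniform_Icc hθ]

theorem ae_noise_differentiableAt (hf : LocallyLipschitz f) {μ : Measure (EuclideanSpace ℝ (Fin d))}
    (hμ : μ ≪ volume) (hμ1 : ∀ᵐ z ∂μ, ‖z‖ < 1) {σ δ L ρ : ℝ} (hσ : 0 < σ)
    (hσ1 : σ ≤ 1) {q : EuclideanSpace ℝ (Fin d) × EuclideanSpace ℝ (Fin d) × ℝ}
    (hq : q ∈ activeStates f σ δ L ρ) :
    ∀ᵐ z ∂μ, ∀ᵐ t : ℝ, DifferentiableAt ℝ f (samplePoint q.1 q.2.1 σ q.2.2 z t) := by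
  obtain ⟨-, -, -, hr, hra, -⟩ := hq
  filter_upwards [hμ.ae_le (ae_ae_differentiableAt_samplePoint hf q.1 q.2.1 hσ hr), hμ1]
    with z hz hz1
  exact hz (add_smul_ne_zero_of_lt hσ1 hr hra hz1)

/-- From an active state, `f` is almost surely differentiable at the sampled point. -/
theorem ae_differentiableAt_sample (hf : LocallyLipschitz f) (hm : m ≤ mΩ)
    (hx : Measurable[m] x) (ha : Measurable[m] a) (hr : Measurable[m] r)
    (hξm : Measurable ξ) (hθm : Measurable θ) (hξ : pdf.IsUniform ξ (Metric.ball 0 1) P volume)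
    (hθ : pdf.IsUniform θ (Set.Icc 0 1) P volume) (hind : IndepFun ξ θ P)
    (hfresh : Indep m (MeasurableSpace.comap (fun ω => (ξ ω, θ ω)) inferInstance) P)
    {σ δ L ρ : ℝ} (hσ : 0 < σ) (hσ1 : σ ≤ 1) :
    ∀ᵐ ω ∂P, (x ω, a ω, r ω) ∈ activeStates f σ δ L ρ →
      DifferentiableAt ℝ f (samplePoint (x ω) (a ω) σ (r ω) (ξ ω) (θ ω)) := by
  have hD : Measurable fun ω => ((x ω, a ω, r ω), (ξ ω, θ ω)) :=
    ((hx.mono hm le_rfl).prodMk ((ha.mono hm le_rfl).prodMk (hr.mono hm le_rfl))).prodMk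
      (hξm.prodMk hθm)
  have : IsProbabilityMeasure (P.map ξ) := Measure.isProbabilityMeasure_map hξm.aemeasurable
  have key : ∀ᵐ q ∂(P.map fun ω => ((x ω, a ω, r ω), (ξ ω, θ ω))),
      q.1 ∈ activeStates f σ δ L ρ → DifferentiableAt ℝ f (sampleMap σ q) := by
    have hdm : MeasurableSet {q | DifferentiableAt ℝ f (sampleMap (d := d) σ q)} :=
      (measurable_sampleMap σ) (measurableSet_of_differentiableAt ℝ f)
    rw [map_state_noise hm hx ha hr hξm hθm hθ hind hfresh, Measure.ae_prod_iff_ae_ae]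
    · refine Eventually.of_forall fun q => ?_
      by_cases hq : q ∈ activeStates f σ δ L ρ
      · simp only [hq, forall_const]
        refine (Measure.ae_prod_iff_ae_ae (hdm.preimage measurable_prodMk_left)).2 ?_
        filter_upwards [ae_noise_differentiableAt hf hξ.absolutelyContinuous
          (ae_norm_lt_one_of_isUniform hξ) hσ hσ1 hq] with z hz
        exact ae_restrict_of_ae hz
      · simp [hq]
    · exact ((measurable_fst (measurableSet_activeStates hf.continuous σ δ L ρ)).compl.union
        hdm).congr (by ext q; simp [imp_iff_not_or])
  exact ae_of_ae_map hD.aemeasurable key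

/-- From an active state, the expected correlation of the current iterate with the sampled
gradient is at most half of its squared norm. -/
theorem setIntegral_inner_gradient_sample_le (hf : LocallyLipschitz f) (hm : m ≤ mΩ)
    (hx : Measurable[m] x) (ha : Measurable[m] a) (hr : Measurable[m] r)
    (hξm : Measurable ξ) (hθm : Measurable θ) (hξ : pdf.IsUniform ξ (Metric.ball 0 1) P volume)
    (hθ : pdf.IsUniform θ (Set.Icc 0 1) P volume) (hind : IndepFun ξ θ P)
    (hfresh : Indep m (MeasurableSpace.comap (fun ω => (ξ ω, θ ω)) inferInstance) P)
    {σ δ ρ : ℝ} {L : ℝ≥0} (hL : LipschitzOnWith L f (Metric.closedBall 0 (ρ + 2)))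
    (hσ : 0 < σ) (hσ1 : σ ≤ 1) (hsmall : 16 * L * σ ≤ δ) :
    IntegrableOn (fun ω => ⟪a ω, gradient f (samplePoint (x ω) (a ω) σ (r ω) (ξ ω) (θ ω))⟫_ℝ)
      {ω | (x ω, a ω, r ω) ∈ activeStates f σ δ L ρ} P ∧
    ∫ ω in {ω | (x ω, a ω, r ω) ∈ activeStates f σ δ L ρ},
      (⟪a ω, gradient f (samplePoint (x ω) (a ω) σ (r ω) (ξ ω) (θ ω))⟫_ℝ - ‖a ω‖ ^ 2 / 2) ∂P
        ≤ 0 := by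
  have hDm : Measurable fun ω => (x ω, a ω, r ω) :=
    (hx.mono hm le_rfl).prodMk ((ha.mono hm le_rfl).prodMk (hr.mono hm le_rfl))
  have hD : Measurable fun ω => ((x ω, a ω, r ω), (ξ ω, θ ω)) := hDm.prodMk (hξm.prodMk hθm)
  have : IsProbabilityMeasure (P.map ξ) := Measure.isProbabilityMeasure_map hξm.aemeasurable
  have : IsProbabilityMeasure (P.map fun ω => (x ω, a ω, r ω)) :=
    Measure.isProbabilityMeasure_map hDm.aemeasurable
  set S := activeStates f σ δ L ρ with hS
  have hSm : MeasurableSet S := measurableSet_activeStates hf.continuous σ δ L ρ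
  have hSm' : MeasurableSet {ω | (x ω, a ω, r ω) ∈ S} := hDm hSm
  have hgm : Measurable fun q => gradient f (sampleMap (d := d) σ q) :=
    measurable_gradient.comp (measurable_sampleMap σ)
  have hGm : Measurable fun q : (EuclideanSpace ℝ (Fin d) × EuclideanSpace ℝ (Fin d) × ℝ) ×
      (EuclideanSpace ℝ (Fin d) × ℝ) => ⟪q.1.2.1, gradient f (sampleMap σ q)⟫_ℝ :=
    measurable_fst.snd.fst.inner hgm
  have hbound : ∀ q : (EuclideanSpace ℝ (Fin d) × EuclideanSpace ℝ (Fin d) × ℝ) ×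
      (EuclideanSpace ℝ (Fin d) × ℝ), q.1 ∈ S → q.2.2 ∈ Set.Icc (0 : ℝ) 1 →
      ‖⟪q.1.2.1, gradient f (sampleMap σ q)⟫_ℝ‖ ≤ L * L := by
    rintro q ⟨-, -, hqL, -, -, hqρ⟩ hq
    refine (norm_inner_le_norm _ _).trans (mul_le_mul hqL ?_ (norm_nonneg _) L.2)
    exact norm_gradient_le_of_lipschitzOnWith (closedBall_mem_nhds_of_mem_closedBall hqρ hσ1
      (dist_samplePoint_le _ _ hσ.le _ _ hq)) hL
  have hint : IntegrableOn
      (fun ω => ⟪a ω, gradient f (samplePoint (x ω) (a ω) σ (r ω) (ξ ω) (θ ω))⟫_ℝ)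
      {ω | (x ω, a ω, r ω) ∈ S} P := by
    refine Measure.integrableOn_of_bounded (M := L * L) (measure_ne_top _ _)
      (hGm.comp hD).aestronglyMeasurable ?_
    filter_upwards [ae_restrict_mem hSm',
      ae_restrict_of_ae (ae_mem_Icc_of_isUniform hθm hθ)] with ω h1 h2
    exact hbound ((x ω, a ω, r ω), (ξ ω, θ ω)) h1 h2
  refine ⟨hint, ?_⟩
  set F : (EuclideanSpace ℝ (Fin d) × EuclideanSpace ℝ (Fin d) × ℝ) ×
      (EuclideanSpace ℝ (Fin d) × ℝ) → ℝ := (Prod.fst ⁻¹' S).indicator fun q =>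
        ⟪q.1.2.1, gradient f (sampleMap σ q)⟫_ℝ - ‖q.1.2.1‖ ^ 2 / 2 with hF
  have hFm : Measurable F := (hGm.sub (by fun_prop)).indicator (measurable_fst hSm)
  have hFint : Integrable F ((P.map fun ω => (x ω, a ω, r ω)).prod
      ((P.map ξ).prod (volume.restrict (Set.Icc (0 : ℝ) 1)))) := by
    rw [← map_state_noise hm hx ha hr hξm hθm hθ hind hfresh,
      integrable_map_measure hFm.aestronglyMeasurable hD.aemeasurable]
    change Integrable ({ω | (x ω, a ω, r ω) ∈ S}.indicator fun ω =>
      ⟪a ω, gradient f (samplePoint (x ω) (a ω) σ (r ω) (ξ ω) (θ ω))⟫_ℝ - ‖a ω‖ ^ 2 / 2) P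
    rw [integrable_indicator_iff hSm']
    refine hint.sub ?_
    refine Measure.integrableOn_of_bounded (M := (L : ℝ) ^ 2 / 2) (measure_ne_top _ _)
      (((ha.mono hm le_rfl).norm.pow_const 2).div_const 2).aestronglyMeasurable ?_
    filter_upwards [ae_restrict_mem hSm'] with ω h1
    obtain ⟨-, -, hL', -⟩ := h1
    rw [Real.norm_of_nonneg (by positivity)]
    gcongr
  have heq : ∫ ω in {ω | (x ω, a ω, r ω) ∈ S},
      (⟪a ω, gradient f (samplePoint (x ω) (a ω) σ (r ω) (ξ ω) (θ ω))⟫_ℝ - ‖a ω‖ ^ 2 / 2) ∂P =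
      ∫ q, F q ∂((P.map fun ω => (x ω, a ω, r ω)).prod
      ((P.map ξ).prod (volume.restrict (Set.Icc (0 : ℝ) 1)))) := by
    rw [← map_state_noise hm hx ha hr hξm hθm hθ hind hfresh,
      integral_map hD.aemeasurable hFm.aestronglyMeasurable, ← integral_indicator hSm']
    rfl
  -- With the state and then the direction noise fixed, the remaining integral over `θ` is the
  -- deterministic segment estimate.
  rw [heq, integral_prod _ hFint]
  refine integral_nonpos_of_ae ?_
  filter_upwards [hFint.prod_right_ae] with q hqint
  by_cases hq : q ∈ S
  · rw [integral_prod _ hqint]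
    refine integral_nonpos_of_ae ?_
    filter_upwards [ae_noise_differentiableAt hf hξ.absolutelyContinuous
      (ae_norm_lt_one_of_isUniform hξ) hσ hσ1 hq, ae_norm_lt_one_of_isUniform hξ] with z hz hz1
    obtain ⟨hd, hδ, hqL, hr0, hra, hqρ⟩ := id hq
    have hstep := setIntegral_inner_gradient_samplePoint_le hL hσ hσ1
      (fun y hy => closedBall_mem_nhds_of_mem_closedBall hqρ hσ1 hy) hd (hsmall.trans hδ) hr0 hra
      hz1 hz
    have hFz : ∀ t, F (q, (z, t)) =
        ⟪q.2.1, gradient f (samplePoint q.1 q.2.1 σ q.2.2 z t)⟫_ℝ - ‖q.2.1‖ ^ 2 / 2 := fun t =>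
      Set.indicator_of_mem (show (q, (z, t)) ∈ Prod.fst ⁻¹' S from hq) _
    simp only [hFz, Pi.zero_apply]
    rw [integral_sub]
    · simpa using hstep
    · refine Measure.integrableOn_of_bounded (M := L * L) (by simp)
        ((hGm.comp (measurable_prodMk_left (x := q))).comp
          (measurable_prodMk_left (x := z))).aestronglyMeasurable ?_
      filter_upwards [ae_restrict_mem measurableSet_Icc] with t ht
      exact hbound (q, (z, t)) hq ht
    · exact integrable_const _
  · have : ∀ n, F (q, n) = 0 := fun n => Set.indicator_of_notMem (by simpa using hq) _
    simp [this]

end OneStep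

theorem gridRadius_pos (G i : ℕ) : 0 < gridRadius G i := by
  unfold gridRadius; positivity

theorem gridRadius_le_one (G i : ℕ) : gridRadius G i ≤ 1 :=
  pow_le_one₀ (by norm_num) (by norm_num)

theorem gridRadius_mono (G : ℕ) {i j : ℕ} (h : i ≤ j) : gridRadius G i ≤ gridRadius G j :=
  pow_le_pow_of_le_one (by norm_num) (by norm_num) (Nat.sub_le_sub_left h G)

theorem norm_le_of_mem_clarkeSubdifferential_closedBall {d : ℕ}
    {f : EuclideanSpace ℝ (Fin d) → ℝ} {L : ℝ≥0} {ρ : ℝ}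
    (hL : LipschitzOnWith L f (Metric.closedBall 0 (ρ + 2))) {x y v : EuclideanSpace ℝ (Fin d)}
    {σ : ℝ} (hx : ‖x‖ ≤ ρ) (hσ : σ ≤ 1) (hy : y ∈ Metric.closedBall x σ)
    (hv : v ∈ clarkeSubdifferential f y) : ‖v‖ ≤ L :=
  norm_le_of_mem_clarkeSubdifferential (closedBall_mem_nhds_of_mem_closedBall hx hσ hy) hL hv

/-! ### Iterates of a run: monotonicity, invariant convex sets, stuck events -/

namespace NTDRun

variable {d : ℕ} {Ω : Type*} [mΩ : MeasurableSpace Ω] {P : Measure Ω}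
  {f : EuclideanSpace ℝ (Fin d) → ℝ} {x₀ g₀ : EuclideanSpace ℝ (Fin d)} {c₀ : ℝ} {G T : ℕ → ℕ}
  (run : NTDRun P f x₀ g₀ c₀ G T)

theorem f_succ_le (k : ℕ) (ω : Ω) : f (run.x (k + 1) ω) ≤ f (run.x k ω) :=
  run.x_succ_min k ω _ (Or.inl rfl)

theorem antitone_f (ω : Ω) : Antitone fun k => f (run.x k ω) :=
  antitone_nat_of_succ_le fun k => run.f_succ_le k ω

theorem f_le (k : ℕ) (ω : Ω) : f (run.x k ω) ≤ f x₀ := by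
  simpa [run.x_zero] using run.antitone_f ω (Nat.zero_le k)

theorem subgradient_mem (hg₀ : g₀ ∈ clarkeSubdifferential f x₀) (k : ℕ) (ω : Ω) :
    run.g k ω ∈ clarkeSubdifferential f (run.x k ω) := by
  cases k with
  | zero => rwa [run.x_zero, run.g_zero]
  | succ k => exact run.g_mem k ω

/-- The trial radii increase with the index, so the ball of radius `σ_i` also contains the points
visited by all earlier calls, through which `g k` is passed on to call `i`. -/
theorem iterates_mem_of_convex {ω : Ω} (hθ : ∀ k i t, run.θ k i t ω ∈ Set.Icc (0 : ℝ) 1)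
    {k i : ℕ} (hi : i < G k) {C : Set (EuclideanSpace ℝ (Fin d))} (hC : Convex ℝ C)
    (hsub : ∀ y ∈ Metric.closedBall (run.x k ω) (gridRadius (G k) i),
      clarkeSubdifferential f y ⊆ C)
    (hg : run.g k ω ∈ C) : ∀ t ≤ T k, run.nIter k i t ω ∈ C := by
  have key : ∀ j ≤ i, run.v k j ω ∈ C ∧ ∀ t ≤ T k, run.nIter k j t ω ∈ C := by
    intro j
    have inner : ∀ j ≤ i, run.v k j ω ∈ C → ∀ t ≤ T k, run.nIter k j t ω ∈ C := by
      intro j hj hv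
      have hsub' : ∀ y ∈ Metric.closedBall (run.x k ω) (gridRadius (G k) j),
          clarkeSubdifferential f y ⊆ C := fun y hy =>
        hsub y (Metric.closedBall_subset_closedBall (gridRadius_mono _ hj) hy)
      have hu := (run.tdescent k ω j (by omega)).mem_of_convex (gridRadius_pos _ _).le hC hv hsub'
        (T k) le_rfl
      exact (run.ndescent k ω j (by omega)).mem_of_convex (gridRadius_pos _ _).le
        (fun t _ => hθ k j t) hC hu hsub'
    induction j with
    | zero =>
      intro hj
      have hv : run.v k 0 ω ∈ C := by rwa [run.v_zero]
      exact ⟨hv, inner 0 hj hv⟩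
    | succ j ih =>
      intro hj
      have hv : run.v k (j + 1) ω ∈ C := by
        rw [run.v_succ k ω j (by omega)]
        exact (ih (by omega)).2 (T k) le_rfl
      exact ⟨hv, inner _ hj hv⟩
  exact (key i le_rfl).2

theorem ae_θ_mem : ∀ᵐ ω ∂P, ∀ k i t, run.θ k i t ω ∈ Set.Icc (0 : ℝ) 1 := by
  simp only [ae_all_iff]
  exact fun k i t => ae_mem_Icc_of_isUniform (run.measurable_θ k i t) (run.uniform_θ k i t)

theorem norm_nIter_le {L : ℝ≥0} {ρ : ℝ}
    (hL : LipschitzOnWith L f (Metric.closedBall 0 (ρ + 2))) (hρ : ∀ y, f y ≤ f x₀ → ‖y‖ ≤ ρ)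
    (hg₀ : g₀ ∈ clarkeSubdifferential f x₀) {ω : Ω}
    (hθ : ∀ k i t, run.θ k i t ω ∈ Set.Icc (0 : ℝ) 1) {k i : ℕ} (hi : i < G k) {t : ℕ}
    (ht : t ≤ T k) : ‖run.nIter k i t ω‖ ≤ L := by
  have hx : ‖run.x k ω‖ ≤ ρ := hρ _ (run.f_le k ω)
  have h := run.iterates_mem_of_convex hθ hi
    (convex_closedBall (0 : EuclideanSpace ℝ (Fin d)) (L : ℝ))
    (fun y hy v hv => by
      simpa using norm_le_of_mem_clarkeSubdifferential_closedBall hL hx (gridRadius_le_one _ _) hy hv)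
    (by simpa using norm_le_of_mem_clarkeSubdifferential_closedBall hL hx zero_le_one (Metric.mem_closedBall_self le_rfl)
          (run.subgradient_mem hg₀ k ω)) t ht
  simpa using h

/-- The event that the `t`-th inner iterate of a call of `NDescent` has norm at least `δ` and does
not achieve descent. -/
def stuck (δ : ℝ) (k i t : ℕ) : Set Ω :=
  {ω | NoDescent f (run.x k ω) (run.nIter k i t ω) (gridRadius (G k) i) ∧
    δ ≤ ‖run.nIter k i t ω‖}

theorem drawIndex_le_drawIndex (k i t : ℕ) : drawIndex k 0 0 ≤ drawIndex k i t := by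
  refine Prod.Lex.toLex_le_toLex.2 (Or.inr ⟨rfl, Prod.Lex.toLex_le_toLex.2 ?_⟩)
  rcases Nat.eq_zero_or_pos i with rfl | hi
  · exact Or.inr ⟨rfl, Nat.zero_le _⟩
  · exact Or.inl hi

theorem measurable_x_hist (k i t : ℕ) : Measurable[run.hist (drawIndex k i t)] (run.x k) :=
  (run.measurable_x k).mono (run.hist.mono (drawIndex_le_drawIndex k i t)) le_rfl

theorem measurable_nIter' {k i t : ℕ} (hi : i < G k) (ht : t ≤ T k) :
    Measurable (run.nIter k i t) :=
  (run.measurable_nIter k i hi t ht).mono (run.hist.le _) le_rfl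

theorem measurableSet_stuck (hf : Continuous f) (δ : ℝ) {k i t : ℕ} (hi : i < G k)
    (ht : t ≤ T k) : MeasurableSet (run.stuck δ k i t) :=
  (measurableSet_noDescent hf ((run.measurable_x_hist k i t).mono (run.hist.le _) le_rfl)
    (run.measurable_nIter' hi ht)).inter
    (measurableSet_le measurable_const (run.measurable_nIter' hi ht).norm)

theorem stuck_succ_subset (δ : ℝ) {k i t : ℕ} (hi : i < G k) (ht : t < T k) :
    run.stuck δ k i (t + 1) ⊆ run.stuck δ k i t := by
  rintro ω ⟨h1, h2⟩
  obtain ⟨h3, h4⟩ := (run.ndescent k ω i hi).noDescent_of_succ ht h1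
  exact ⟨h3, h2.trans h4⟩

/-- The additional bounds in `activeStates` hold almost surely along a run. They are imposed there
so that the one-step estimates have uniform constants. -/
theorem ae_stuck_iff {L : ℝ≥0} {ρ : ℝ}
    (hL : LipschitzOnWith L f (Metric.closedBall 0 (ρ + 2))) (hρ : ∀ y, f y ≤ f x₀ → ‖y‖ ≤ ρ)
    (hg₀ : g₀ ∈ clarkeSubdifferential f x₀) (δ : ℝ) {k i t : ℕ} (hi : i < G k) (ht : t < T k) :
    ∀ᵐ ω ∂P, ω ∈ run.stuck δ k i t ↔ (run.x k ω, run.nIter k i t ω, run.radius k i t ω) ∈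
      activeStates f (gridRadius (G k) i) δ L ρ := by
  filter_upwards [run.ae_θ_mem] with ω hθ
  constructor
  · rintro ⟨h1, h2⟩
    obtain ⟨h3, h4⟩ := (run.ndescent k ω i hi).radius_mem t ht h1
    exact ⟨h1, h2, run.norm_nIter_le hL hρ hg₀ hθ hi ht.le, h3, h4, hρ _ (run.f_le k ω)⟩
  · rintro ⟨h1, h2, -⟩
    exact ⟨h1, h2⟩

/-! ### Contraction of the expected squared norm and Borel–Cantelli -/

variable [IsProbabilityMeasure P]

theorem integrable_norm_nIter_sq {L : ℝ≥0} {ρ : ℝ}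
    (hL : LipschitzOnWith L f (Metric.closedBall 0 (ρ + 2))) (hρ : ∀ y, f y ≤ f x₀ → ‖y‖ ≤ ρ)
    (hg₀ : g₀ ∈ clarkeSubdifferential f x₀) {k i t : ℕ} (hi : i < G k) (ht : t ≤ T k) :
    Integrable (fun ω => ‖run.nIter k i t ω‖ ^ 2) P := by
  refine Integrable.of_bound ((run.measurable_nIter' hi ht).norm.pow_const 2).aestronglyMeasurable
    ((L : ℝ) ^ 2) ?_
  filter_upwards [run.ae_θ_mem] with ω hθ
  rw [Real.norm_of_nonneg (by positivity)]
  exact pow_le_pow_left₀ (norm_nonneg _) (run.norm_nIter_le hL hρ hg₀ hθ hi ht) 2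

/-- Along stuck steps the expected squared norm of the iterate decreases geometrically. -/
theorem setIntegral_norm_sq_succ_le (hf : LocallyLipschitz f) {L : ℝ≥0} {ρ : ℝ}
    (hL : LipschitzOnWith L f (Metric.closedBall 0 (ρ + 2))) (hρ : ∀ y, f y ≤ f x₀ → ‖y‖ ≤ ρ)
    (hg₀ : g₀ ∈ clarkeSubdifferential f x₀) {δ : ℝ} (hδ : 0 < δ) (hδL : δ ≤ L)
    {k i t : ℕ} (hi : i < G k) (ht : t < T k) (hsmall : 16 * L * gridRadius (G k) i ≤ δ) :
    ∫ ω in run.stuck δ k i (t + 1), ‖run.nIter k i (t + 1) ω‖ ^ 2 ∂P ≤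
      (1 - δ ^ 2 / (16 * L ^ 2)) * ∫ ω in run.stuck δ k i t, ‖run.nIter k i t ω‖ ^ 2 ∂P := by
  set σ := gridRadius (G k) i
  -- This `l` minimizes `-lδ² + 4l²L²`, the expected change when `‖a‖ = δ`; the quadratic error then
  -- equals `lδ²/2` and costs half of the gain.
  set l : ℝ := δ ^ 2 / (8 * L ^ 2) with hl
  have hLpos : (0 : ℝ) < L := hδ.trans_le hδL
  have hl0 : 0 ≤ l := by positivity
  have hl1 : l ≤ 1 := by
    rw [hl, div_le_one (by positivity)]
    nlinarith
  have hσ : 0 < σ := gridRadius_pos _ _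
  have hσ1 : σ ≤ 1 := gridRadius_le_one _ _
  have hm := run.hist.le (drawIndex k i t)
  have hxm := run.measurable_x_hist k i t
  have ham := run.measurable_nIter k i hi t ht.le
  have hrm := run.measurable_radius k i hi t ht
  have hRm := run.measurableSet_stuck hf.continuous δ hi ht.le
  have hRS : run.stuck δ k i t =ᵐ[P] {ω | (run.x k ω, run.nIter k i t ω, run.radius k i t ω) ∈
      activeStates f σ δ L ρ} := by
    filter_upwards [run.ae_stuck_iff hL hρ hg₀ δ hi ht] with ω hω
    exact propext hω
  obtain ⟨hint, hcorr⟩ := setIntegral_inner_gradient_sample_le hf hm hxm ham hrm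
    (run.measurable_ξ k i t) (run.measurable_θ k i t) (run.uniform_ξ k i t) (run.uniform_θ k i t)
    (run.indep_ξ_θ k i t) (run.indep_hist k i t) hL hσ hσ1 hsmall
  rw [← setIntegral_congr_set hRS] at hcorr
  replace hint := hint.congr_set_ae hRS
  set c : Ω → ℝ := fun ω => ⟪run.nIter k i t ω, gradient f (samplePoint (run.x k ω)
    (run.nIter k i t ω) σ (run.radius k i t ω) (run.ξ k i t ω) (run.θ k i t ω))⟫_ℝ with hc
  have hia := (run.integrable_norm_nIter_sq hL hρ hg₀ hi ht.le).integrableOn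
    (s := run.stuck δ k i t)
  have hia' := (run.integrable_norm_nIter_sq hL hρ hg₀ hi (Nat.succ_le_of_lt ht)).integrableOn
    (s := run.stuck δ k i t)
  have hic : IntegrableOn (fun ω => 2 * l * (c ω - ‖run.nIter k i t ω‖ ^ 2 / 2))
      (run.stuck δ k i t) P := (hint.sub (hia.div_const 2)).const_mul _
  have hstep : ∀ᵐ ω ∂P, ω ∈ run.stuck δ k i t → ‖run.nIter k i (t + 1) ω‖ ^ 2 ≤
      (1 - l / 2) * ‖run.nIter k i t ω‖ ^ 2 + 2 * l * (c ω - ‖run.nIter k i t ω‖ ^ 2 / 2) := by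
    filter_upwards [run.ae_θ_mem, run.ae_stuck_iff hL hρ hg₀ δ hi ht,
      run.nSub_eq_gradient k i hi t ht,
      ae_differentiableAt_sample (δ := δ) (L := L) (ρ := ρ) hf hm hxm ham hrm (run.measurable_ξ k i t)
        (run.measurable_θ k i t) (run.uniform_ξ k i t) (run.uniform_θ k i t)
        (run.indep_ξ_θ k i t) (run.indep_hist k i t) hσ hσ1] with ω hθ hiff hgrad hdiff hω
    have hact := hiff.1 hω
    have hsub := hgrad hω.1 (hdiff hact)
    have hmin := (run.ndescent k ω i hi).step t ht hω.1
    have hx : ‖run.x k ω‖ ≤ ρ := hρ _ (run.f_le k ω)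
    have hs : ‖run.nSub k i t ω‖ ≤ L := norm_le_of_mem_clarkeSubdifferential_closedBall hL hx hσ1
      (dist_samplePoint_le _ _ hσ.le _ _ (hθ k i t))
      ((run.ndescent k ω i hi).choose_mem t ht hω.1)
    have hsq := hmin.norm_sq_le (run.norm_nIter_le hL hρ hg₀ hθ hi ht.le) hs hl0 hl1
    -- The upper bound now involves the gradient, a measurable function of state and noise, so no
    -- measurability of the chosen subgradient is needed.
    rw [hsub] at hsq
    have hδsq : δ ^ 2 ≤ ‖run.nIter k i t ω‖ ^ 2 := pow_le_pow_left₀ hδ.le hω.2 2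
    have h4 : 4 * l ^ 2 * (L : ℝ) ^ 2 = l / 2 * δ ^ 2 := by
      rw [hl]; field_simp; ring
    rw [h4] at hsq
    have := mul_le_mul_of_nonneg_left hδsq hl0
    simp only [hc]
    linarith
  calc ∫ ω in run.stuck δ k i (t + 1), ‖run.nIter k i (t + 1) ω‖ ^ 2 ∂P
      ≤ ∫ ω in run.stuck δ k i t, ‖run.nIter k i (t + 1) ω‖ ^ 2 ∂P :=
        setIntegral_mono_set hia' (Eventually.of_forall fun _ => by positivity)
          (run.stuck_succ_subset δ hi ht).eventuallyLE
    _ ≤ ∫ ω in run.stuck δ k i t, ((1 - l / 2) * ‖run.nIter k i t ω‖ ^ 2 +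
          2 * l * (c ω - ‖run.nIter k i t ω‖ ^ 2 / 2)) ∂P :=
        setIntegral_mono_on_ae hia' (Integrable.fun_add (hia.const_mul _) hic) hRm hstep
    _ = (1 - l / 2) * (∫ ω in run.stuck δ k i t, ‖run.nIter k i t ω‖ ^ 2 ∂P) +
          2 * l * ∫ ω in run.stuck δ k i t, (c ω - ‖run.nIter k i t ω‖ ^ 2 / 2) ∂P := by
        rw [integral_add (hia.const_mul _) hic, integral_const_mul, integral_const_mul]
    _ ≤ (1 - l / 2) * ∫ ω in run.stuck δ k i t, ‖run.nIter k i t ω‖ ^ 2 ∂P := by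
        have := mul_nonpos_of_nonneg_of_nonpos (mul_nonneg zero_le_two hl0) hcorr
        linarith
    _ = _ := by
        congr 2
        rw [hl]; field_simp; norm_num

/-- A call of `NDescent` stays stuck with probability exponentially small in the budget. -/
theorem measureReal_stuck_le (hf : LocallyLipschitz f) {L : ℝ≥0} {ρ : ℝ}
    (hL : LipschitzOnWith L f (Metric.closedBall 0 (ρ + 2))) (hρ : ∀ y, f y ≤ f x₀ → ‖y‖ ≤ ρ)
    (hg₀ : g₀ ∈ clarkeSubdifferential f x₀) {δ : ℝ} (hδ : 0 < δ) (hδL : δ ≤ L)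
    {k i : ℕ} (hi : i < G k) (hsmall : 16 * L * gridRadius (G k) i ≤ δ) :
    P.real (run.stuck δ k i (T k)) ≤
      L ^ 2 / δ ^ 2 * (1 - δ ^ 2 / (16 * L ^ 2)) ^ T k := by
  have hLpos : (0 : ℝ) < L := hδ.trans_le hδL
  have hc : 0 ≤ 1 - δ ^ 2 / (16 * (L : ℝ) ^ 2) := by
    rw [sub_nonneg, div_le_one (by positivity)]
    nlinarith
  have hdecay : ∀ t ≤ T k, ∫ ω in run.stuck δ k i t, ‖run.nIter k i t ω‖ ^ 2 ∂P ≤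
      (1 - δ ^ 2 / (16 * L ^ 2)) ^ t * (L : ℝ) ^ 2 := by
    intro t
    induction t with
    | zero =>
      intro _
      rw [pow_zero, one_mul]
      calc ∫ ω in run.stuck δ k i 0, ‖run.nIter k i 0 ω‖ ^ 2 ∂P
          ≤ ∫ ω, ‖run.nIter k i 0 ω‖ ^ 2 ∂P :=
            setIntegral_le_integral (run.integrable_norm_nIter_sq hL hρ hg₀ hi (Nat.zero_le _))
              (Eventually.of_forall fun _ => by positivity)
        _ ≤ ∫ _, (L : ℝ) ^ 2 ∂P := by
            refine integral_mono_ae (run.integrable_norm_nIter_sq hL hρ hg₀ hi (Nat.zero_le _))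
              (integrable_const _) ?_
            filter_upwards [run.ae_θ_mem] with ω hθ
            exact pow_le_pow_left₀ (norm_nonneg _)
              (run.norm_nIter_le hL hρ hg₀ hθ hi (Nat.zero_le _)) 2
        _ = (L : ℝ) ^ 2 := by simp
    | succ t ih =>
      intro ht
      refine (run.setIntegral_norm_sq_succ_le hf hL hρ hg₀ hδ hδL hi ht hsmall).trans ?_
      rw [pow_succ' (1 - _), mul_assoc]
      exact mul_le_mul_of_nonneg_left (ih (by omega)) hc
  have hlow : δ ^ 2 * P.real (run.stuck δ k i (T k)) ≤
      ∫ ω in run.stuck δ k i (T k), ‖run.nIter k i (T k) ω‖ ^ 2 ∂P := by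
    have h := setIntegral_mono_on (μ := P) (f := fun _ => δ ^ 2) (integrable_const _)
      (run.integrable_norm_nIter_sq hL hρ hg₀ hi le_rfl).integrableOn
      (run.measurableSet_stuck hf.continuous δ hi le_rfl)
      (fun ω hω => pow_le_pow_left₀ hδ.le hω.2 2)
    rwa [setIntegral_const, smul_eq_mul, mul_comm] at h
  have := hlow.trans (hdecay (T k) le_rfl)
  rw [div_mul_eq_mul_div, le_div_iff₀ (by positivity)]
  linarith

/-- For a fixed trial radius `2⁻ᵐ` and a fixed `δ`, almost surely only finitely many calls of
`NDescent` end stuck. -/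
theorem ae_eventually_notMem_stuck (hf : LocallyLipschitz f) {L : ℝ≥0} {ρ : ℝ}
    (hL : LipschitzOnWith L f (Metric.closedBall 0 (ρ + 2))) (hρ : ∀ y, f y ≤ f x₀ → ‖y‖ ≤ ρ)
    (hg₀ : g₀ ∈ clarkeSubdifferential f x₀) (hG : Tendsto G atTop atTop) (hT : ∀ k, k ≤ T k)
    {δ : ℝ} (hδ : 0 < δ) (hδL : δ ≤ L) {m : ℕ} (hm : 0 < m)
    (hsmall : 16 * L * (2 : ℝ)⁻¹ ^ m ≤ δ) :
    ∀ᵐ ω ∂P, ∀ᶠ k in atTop, ω ∉ run.stuck δ k (G k - m) (T k) := by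
  have hLpos : (0 : ℝ) < L := hδ.trans_le hδL
  set c : ℝ := 1 - δ ^ 2 / (16 * (L : ℝ) ^ 2) with hcdef
  have hc0 : 0 ≤ c := by
    rw [hcdef, sub_nonneg, div_le_one (by positivity)]
    nlinarith
  have hc1 : c < 1 := by
    have : 0 < δ ^ 2 / (16 * (L : ℝ) ^ 2) := by positivity
    linarith
  obtain ⟨N, hN⟩ := eventually_atTop.1 (hG.eventually_ge_atTop m)
  have hbound : ∀ k, P (run.stuck δ (k + N) (G (k + N) - m) (T (k + N))) ≤
      ENNReal.ofReal (L ^ 2 / δ ^ 2 * c ^ k) := by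
    intro k
    have hGk : m ≤ G (k + N) := hN _ (Nat.le_add_left _ _)
    -- Once `G k ≥ m`, the radius `2⁻ᵐ` sits at index `G k - m`, below `G k` because `m > 0`.
    have hrad : gridRadius (G (k + N)) (G (k + N) - m) = (2 : ℝ)⁻¹ ^ m := by
      rw [gridRadius, Nat.sub_sub_self hGk]
    rw [← ofReal_measureReal]
    refine ENNReal.ofReal_le_ofReal ((run.measureReal_stuck_le hf hL hρ hg₀ hδ hδL (by omega)
      (by rwa [hrad])).trans ?_)
    have hkT : k ≤ T (k + N) := (Nat.le_add_right _ _).trans (hT _)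
    exact mul_le_mul_of_nonneg_left (pow_le_pow_of_le_one hc0 hc1.le hkT) (by positivity)
  have hsum : ∑' k, P (run.stuck δ (k + N) (G (k + N) - m) (T (k + N))) ≠ ∞ :=
    ne_top_of_le_ne_top ((summable_geometric_of_lt_one hc0 hc1).mul_left _).tsum_ofReal_ne_top
      (ENNReal.tsum_le_tsum hbound)
  filter_upwards [ae_eventually_notMem hsum] with ω hω
  rw [eventually_atTop] at hω ⊢
  obtain ⟨M, hM⟩ := hω
  refine ⟨M + N, fun k hk => ?_⟩
  have := hM (k - N) (by omega)
  rwa [Nat.sub_add_cancel (by omega)] at this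

end NTDRun

namespace NTDRun

variable {d : ℕ} {Ω : Type*} [mΩ : MeasurableSpace Ω] {P : Measure Ω}
  {f : EuclideanSpace ℝ (Fin d) → ℝ} {x₀ g₀ : EuclideanSpace ℝ (Fin d)} {c₀ : ℝ} {G T : ℕ → ℕ}
  (run : NTDRun P f x₀ g₀ c₀ G T)

/-- An outer iteration in which some call of `NDescent` ends with a long vector and is not stuck
decreases the function value. -/
theorem f_succ_le_sub {L : ℝ≥0} {ρ : ℝ}
    (hL : LipschitzOnWith L f (Metric.closedBall 0 (ρ + 2))) (hρ : ∀ y, f y ≤ f x₀ → ‖y‖ ≤ ρ)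
    (hg₀ : g₀ ∈ clarkeSubdifferential f x₀) (hg₀_ne : g₀ ≠ 0) (hc₀ : 0 < c₀) (hc₀_le : c₀ ≤ 1)
    {ω : Ω} {k i : ℕ} (hi : i < G k) {δ : ℝ} (hδ : 0 < δ)
    (hsmall : L * gridRadius (G k) i ≤ δ) (hv : δ ≤ ‖run.nIter k i (T k) ω‖)
    (hstuck : ω ∉ run.stuck δ k i (T k)) :
    f (run.x (k + 1) ω) ≤ f (run.x k ω) - gridRadius (G k) i / 8 * δ := by
  have hσ := gridRadius_pos (G k) i
  have hx : ‖run.x k ω‖ ≤ ρ := hρ _ (run.f_le k ω)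
  have hs : max ‖run.g k ω‖ (c₀ * ‖g₀‖) ≤ L := by
    refine max_le (norm_le_of_mem_clarkeSubdifferential_closedBall hL hx zero_le_one
      (Metric.mem_closedBall_self le_rfl) (run.subgradient_mem hg₀ k ω)) ?_
    have h0 := norm_le_of_mem_clarkeSubdifferential_closedBall hL (hρ x₀ le_rfl) zero_le_one
      (Metric.mem_closedBall_self le_rfl) hg₀
    nlinarith [norm_nonneg g₀]
  have hspos : 0 < max ‖run.g k ω‖ (c₀ * ‖g₀‖) :=
    lt_max_of_lt_right (mul_pos hc₀ (norm_pos_iff.2 hg₀_ne))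
  -- The trust region parameter is at most `L`, so `Lσ ≤ δ ≤ ‖v‖` admits the candidate.
  have hmin := run.x_succ_min k ω
    (normalizedStep (run.x k ω) (run.v k (i + 1) ω) (gridRadius (G k) i)) (by
      refine Or.inr ⟨i, hi, ?_, rfl⟩
      change _ ≤ ‖run.v k (i + 1) ω‖ / _
      rw [le_div_iff₀ hspos, run.v_succ k ω i hi]
      nlinarith)
  rw [run.v_succ k ω i hi] at hmin
  have hno : ¬ NoDescent f (run.x k ω) (run.nIter k i (T k) ω) (gridRadius (G k) i) :=
    fun h => hstuck ⟨h, hv⟩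
  have hdesc := lt_of_not_ge fun h => hno ⟨hδ.trans_le hv, h⟩
  nlinarith

/-- The monotone bounded values converge, so consecutive differences tend to `0`. -/
theorem not_frequently_f_succ_le_sub {ω : Ω} (hbelow : BddBelow (Set.range fun k => f (run.x k ω)))
    {η : ℝ} (hη : 0 < η) : ¬ ∃ᶠ k in atTop, f (run.x (k + 1) ω) ≤ f (run.x k ω) - η := by
  have hlim := tendsto_atTop_ciInf (run.antitone_f ω) hbelow
  have hdiff := hlim.sub (hlim.comp (tendsto_add_atTop_nat 1))
  rw [sub_self] at hdiff
  rw [not_frequently]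
  filter_upwards [hdiff.eventually_lt_const hη] with k hk hk'
  simp only [Function.comp_apply] at hk
  linarith

end NTDRun

/-! ### Contradiction at a limit point that is not critical -/

theorem mainTheorem8 {d : ℕ} {Ω : Type*} [MeasurableSpace Ω] (P : Measure Ω)
    [IsProbabilityMeasure P] (f : EuclideanSpace ℝ (Fin d) → ℝ) (hf : LocallyLipschitz f)
    (x₀ g₀ : EuclideanSpace ℝ (Fin d)) (hg₀ : g₀ ∈ clarkeSubdifferential f x₀) (hg₀_ne : g₀ ≠ 0)
    (hbdd : Bornology.IsBounded {x | f x ≤ f x₀})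
    (c₀ : ℝ) (hc₀_pos : 0 < c₀) (hc₀_le : c₀ ≤ 1)
    (G T : ℕ → ℕ) (hG : Tendsto G atTop atTop) (hT : ∀ k, k ≤ T k)
    (run : NTDRun P f x₀ g₀ c₀ G T) :
    ∀ᵐ ω ∂P, ∀ xbar : EuclideanSpace ℝ (Fin d),
      MapClusterPt xbar atTop (fun k => run.x k ω) → IsClarkeCritical f xbar := by
  obtain ⟨ρ, hρ'⟩ := hbdd.exists_norm_le
  have hρ : ∀ y, f y ≤ f x₀ → ‖y‖ ≤ ρ := fun y hy => hρ' y hy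
  obtain ⟨L, hL⟩ := hf.exists_lipschitzOnWith_closedBall (ρ + 2)
  have hLpos : (0 : ℝ) < L := (norm_pos_iff.2 hg₀_ne).trans_le
    (norm_le_of_mem_clarkeSubdifferential_closedBall hL (hρ x₀ le_rfl) zero_le_one
      (Metric.mem_closedBall_self le_rfl) hg₀)
  -- Thresholds `1/(n+1)` and radii `2⁻ᵐ` form a countable family, so one null set serves all limit
  -- points, although `δ` and `σ` depend on `xbar` and `ω`.
  have hescape : ∀ᵐ ω ∂P, ∀ n m : ℕ, 1 / ((n : ℝ) + 1) ≤ L → 0 < m →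
      16 * L * (2 : ℝ)⁻¹ ^ m ≤ 1 / ((n : ℝ) + 1) →
      ∀ᶠ k in atTop, ω ∉ run.stuck (1 / ((n : ℝ) + 1)) k (G k - m) (T k) := by
    simp only [ae_all_iff]
    exact fun n m h1 hm h2 => run.ae_eventually_notMem_stuck hf hL hρ hg₀ hG hT (by positivity)
      h1 hm h2
  filter_upwards [hescape, run.ae_θ_mem] with ω hω hθ xbar hcluster
  by_contra hcrit
  obtain ⟨w, u, hu, ε, hε, hsep⟩ := exists_uniform_separation hf hcrit
  have hnorm : ∀ v, u ≤ ⟪w, v⟫_ℝ → u / (‖w‖ + 1) ≤ ‖v‖ := fun v hv => by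
    rw [div_le_iff₀ (by positivity)]
    nlinarith [real_inner_le_norm w v, norm_nonneg v]
  obtain ⟨n, hn⟩ := exists_nat_one_div_lt (show 0 < min (u / (‖w‖ + 1)) L by positivity)
  set δ : ℝ := 1 / ((n : ℝ) + 1) with hδ_def
  have hδ : 0 < δ := by positivity
  -- The bound `ε/2` keeps the trial ball around `x_k` inside `B_ε(xbar)`, `δ/(16L)` permits the
  -- contraction estimate, and `1` forces `m > 0`.
  obtain ⟨m, hm⟩ := exists_pow_lt_of_lt_one
    (show 0 < min (min (ε / 2) (δ / (16 * L))) 1 by positivity) (show (2 : ℝ)⁻¹ < 1 by norm_num)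
  rw [lt_min_iff, lt_min_iff, lt_div_iff₀ (show 0 < 16 * (L : ℝ) by positivity)] at hm
  obtain ⟨⟨hmε, hmδ⟩, hm1⟩ := hm
  have hm0 : 0 < m := Nat.pos_of_ne_zero fun h => by simp [h] at hm1
  have hsmall : 16 * L * (2 : ℝ)⁻¹ ^ m ≤ δ := by linarith
  have hσpos : (0 : ℝ) < (2 : ℝ)⁻¹ ^ m := by positivity
  have hbelow : BddBelow (Set.range fun k => f (run.x k ω)) := by
    refine ((isCompact_closedBall (0 : EuclideanSpace ℝ (Fin d)) ρ).bddBelow_image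
      hf.continuous.continuousOn).mono ?_
    rintro _ ⟨k, rfl⟩
    exact ⟨run.x k ω, by simpa using hρ _ (run.f_le k ω), rfl⟩
  refine run.not_frequently_f_succ_le_sub hbelow
    (show 0 < (2 : ℝ)⁻¹ ^ m / 8 * δ by positivity) ?_
  have hfreq : ∃ᶠ k in atTop, run.x k ω ∈ Metric.ball xbar (ε / 2) :=
    hcluster.frequently (Metric.ball_mem_nhds _ (half_pos hε))
  refine (hfreq.and_eventually ((hω n m (hn.le.trans (min_le_right _ _)) hm0 hsmall).and
    (hG.eventually_ge_atTop m))).mono ?_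
  rintro k ⟨hxk, hstuck, hGk⟩
  have hi : G k - m < G k := by omega
  have hrad : gridRadius (G k) (G k - m) = (2 : ℝ)⁻¹ ^ m := by
    rw [gridRadius, Nat.sub_sub_self hGk]
  have hball : ∀ y ∈ Metric.closedBall (run.x k ω) ((2 : ℝ)⁻¹ ^ m), y ∈ Metric.ball xbar ε := by
    intro y hy
    rw [Metric.mem_ball] at hxk ⊢
    rw [Metric.mem_closedBall] at hy
    linarith [dist_triangle y (run.x k ω) xbar]
  have hmem := run.iterates_mem_of_convex hθ hi
    (convex_halfSpace_ge ⟨fun a b => inner_add_right w a b, fun c a => by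
      simp [inner_smul_right]⟩ u)
    (fun y hy v hv => hsep y (hball y (by rwa [hrad] at hy)) v hv)
    (hsep _ (hball _ (Metric.mem_closedBall_self hσpos.le)) _ (run.subgradient_mem hg₀ k ω))
    (T k) le_rfl
  have hv : δ ≤ ‖run.nIter k (G k - m) (T k) ω‖ :=
    (hn.le.trans (min_le_left _ _)).trans (hnorm _ hmem)
  have := run.f_succ_le_sub hL hρ hg₀ hg₀_ne hc₀_pos hc₀_le hi hδ
    (by rw [hrad]; nlinarith) hv hstuck
  rwa [hrad] at this
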